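/- Consider the real, autonomous, multilinear equation on the lattice $\mathbb Z^2$ $$\begin{aligned}\mathcal Q^+ :={}& a_1(u_{n,m}+u_{n+1,m+1})+a_2(u_{n+1,m}+u_{n,m+1})\\ &+(\alpha_1-\alpha_2)u_{n,m}u_{n+1,m}+(\alpha_1+\alpha_2)u_{n,m+1}u_{n+1,m+1}\\ &+(\beta_1-\beta_2)u_{n,m}u_{n,m+1}+(\beta_1+\beta_2)u_{n+1,m}u_{n+1,m+1}\\ &+\gamma_1u_{n,m}u_{n+1,m+1}+\gamma_2u_{n+1,m}u_{n,m+1}\\ &+(\xi_1-\xi_3)u_{n,m}u_{n+1,m}u_{n,m+1}+(\xi_1+\xi_3)u_{n,m}u_{n+1,m}u_{n+1,m+1}\\ &+(\xi_2-\xi_4)u_{n+1,m}u_{n,m+1}u_{n+1,m+1}+(\xi_2+\xi_4)u_{n,m}u_{n,m+1}u_{n+1,m+1}\\ &+\zeta\,u_{n,m}u_{n+1,m}u_{n,m+1}u_{n+1,m+1}=0\end{aligned}$$ with real coefficients, $a_1,a_2\neq0$, $|a_1|\ne|a_2|$. A dispersion relation is a differentiable function $\omega:\mathbb R\to\mathbb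 R$ such that for every $k$ the wave $e^{i(kn-\omega(k)m)}$ solves the linear part. Let $K=e^{i\kappa}$, $\Omega=e^{-i\omega(\kappa)}$. Call $\kappa$ nonresonant if $\sin\kappa\neq0$ and $a_1(1+K^2\Omega^2)+a_2(K^2+\Omega^2)\ne0$. Insert the multiscale expansion $$u_{n,m}=\sum_{\ell\ge1}\varepsilon^{\ell}\sum_{|\alpha|\le\ell}K^{\alpha n}\Omega^{\alpha m}\,u^{(\alpha)}_\ell(n_1,m_1,m_2,\dots),\qquad n_1=\varepsilon n,\quad m_j=\varepsilon^jm,$$ into $\mathcal Q^+$, the shifts of the amplitudes being expanded in Taylor series in $\varepsilon$, and let $\mathcal W_j^{(\alpha)}$ be the coefficient of $\varepsilon^jK^{\alpha n}\Omega^{\alpha m}$ in the result. The amplitudes are smooth and bounded, satisfy $u_\ell^{(-\alpha)}=\overline{u_\ell^{(\alpha)}}$, and depend on $n_1,m_1$ only through $\xi=n_1-\omega'(\kappa)m_1$. One says that at $\kappa$ the equation reduces to the nonlinear Schrödinger equation (NLSE) with coefficients $\rho_1,\rho_2\in\mathbb C$ if there is a constant $c\ne0$ such that, for all such amplitudes with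 $\mathcal W_1^{(\alpha)}=\mathcal W_2^{(\alpha)}=0$ for all $\alpha$, $$\mathcal W_3^{(1)}=c\,\bigl(i\,\partial_{m_2}u+\rho_1\,\partial_\xi^2u+\rho_2\,u|u|^2\bigr),\qquad u=u_1^{(1)}.$$ The equation passes the $A_1$ test if, for every dispersion relation and every nonresonant $\kappa$, it reduces to an NLSE with real $\rho_1,\rho_2$. Consider the six families of conditions: (S1) $\alpha_2=\beta_2=0$, $\xi_1=\xi_2$, $\xi_3=\xi_4$. (S2) $\alpha_2=\beta_2$, $\alpha_1=\beta_1$, $a_1=2a_2$, $\gamma_1=2\gamma_2$, $a_1(\xi_1-\xi_2)=-a_1(\xi_3-\xi_4)=-2\alpha_2\gamma_2$. (S3) $\alpha_2=-\beta_2$, $\alpha_1=\beta_1$, $a_2=2a_1$, $\gamma_2=2\gamma_1$, $a_1(\xi_1-\xi_2)=a_1(\xi_3-\xi_4)=-\alpha_2\gamma_1$. (S4) $a_2\alpha_1=a_2\beta_1=\frac12(a_1+a_2)\gamma_2$, $a_2\gamma_1=a_1\gamma_2$, $a_1(\xi_1-\xi_2)=-\alpha_2\gamma_1$, $a_1(\xi_3-\xi_4)=\beta_2\gamma_1$.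 (S5) $(a_2-a_1)\beta_2=(a_2+a_1)\alpha_2$, $2a_1a_2(a_1-a_2)\alpha_1=(a_1+a_2)(\gamma_2a_1^2-\gamma_1a_2^2)$, $2a_1a_2\beta_1=\gamma_1a_2^2+\gamma_2a_1^2$, $(a_2-a_1)(\xi_1-\xi_2)=(\gamma_1-\gamma_2)\alpha_2$, $(a_2-a_1)^2(\xi_3-\xi_4)=[\gamma_2(a_2-3a_1)-\gamma_1(a_1-3a_2)]\alpha_2$. (S6) $(a_2+a_1)\beta_2=(a_2-a_1)\alpha_2$, $2a_1a_2\alpha_1=\gamma_1a_2^2+\gamma_2a_1^2$, $2a_1a_2(a_1-a_2)\beta_1=(a_1+a_2)(\gamma_2a_1^2-\gamma_1a_2^2)$, $(a_2^2-a_1^2)(\xi_1-\xi_2)=[\gamma_1(a_1-3a_2)-\gamma_2(a_2-3a_1)]\alpha_2$, $(a_1+a_2)(\xi_3-\xi_4)=(\gamma_2-\gamma_1)\alpha_2$. **Statement.** If the coefficients satisfy none of (S1)–(S6), then $\mathcal Q^+$ is not integrable, in the sense that it fails the $A_1$ test: for every dispersion relation and every nonresonant $\kappa$ the equation reduces to an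 NLSE with uniquely determined coefficients $\rho_1,\rho_2\in\mathbb C$, but not for all of them are both coefficients real. -/

import Mathlib

open scoped LaurentPolynomial ComplexConjugate

noncomputable section

namespace QPlus

/-- The 13 real coefficients of an equation of the class `Q⁺`. -/
structure Coeffs where
  a₁ : ℝ
  a₂ : ℝ
  α₁ : ℝ
  α₂ : ℝ
  β₁ : ℝ
  β₂ : ℝ
  γ₁ : ℝ
  γ₂ : ℝ
  ξ₁ : ℝ
  ξ₂ : ℝ
  ξ₃ : ℝ
  ξ₄ : ℝ
  ζ : ℝ

/-- The multilinear polynomial `Q⁺` evaluated at `u₀₀ = u_{n,m}`, `u₁₀ = u_{n+1,m}`,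
`u₀₁ = u_{n,m+1}`, `u₁₁ = u_{n+1,m+1}`, in any commutative real algebra. -/
def Q (P : Coeffs) {R : Type*} [CommRing R] [Algebra ℝ R] (u₀₀ u₁₀ u₀₁ u₁₁ : R) : R :=
  P.a₁ • (u₀₀ + u₁₁) + P.a₂ • (u₁₀ + u₀₁)
    + (P.α₁ - P.α₂) • (u₀₀ * u₁₀) + (P.α₁ + P.α₂) • (u₀₁ * u₁₁)
    + (P.β₁ - P.β₂) • (u₀₀ * u₀₁) + (P.β₁ + P.β₂) • (u₁₀ * u₁₁)
    + P.γ₁ • (u₀₀ * u₁₁) + P.γ₂ • (u₁₀ * u₀₁)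
    + (P.ξ₁ - P.ξ₃) • (u₀₀ * u₁₀ * u₀₁) + (P.ξ₁ + P.ξ₃) • (u₀₀ * u₁₀ * u₁₁)
    + (P.ξ₂ - P.ξ₄) • (u₁₀ * u₀₁ * u₁₁) + (P.ξ₂ + P.ξ₄) • (u₀₀ * u₀₁ * u₁₁)
    + P.ζ • (u₀₀ * u₁₀ * u₀₁ * u₁₁)

/-- Symbol of the linear part of `Q⁺`: its value on `u_{n,m} = Kⁿ Ωᵐ`, divided by `Kⁿ Ωᵐ`. -/
def linSymbol (P : Coeffs) (K Ω : ℂ) : ℂ :=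
  P.a₁ * (1 + K * Ω) + P.a₂ * (K + Ω)

/-- The wave factor `K = e^{iκ}`. -/
def waveK (κ : ℝ) : ℂ := Complex.exp (Complex.I * (κ : ℂ))

/-- The wave factor `Ω = e^{-iω(κ)}`. -/
def waveΩ (ω : ℝ → ℝ) (κ : ℝ) : ℂ := Complex.exp (-(Complex.I * (ω κ : ℂ)))

/-- `ω` is a (real, differentiable) dispersion relation of `Q⁺`: for every wave number `k`
the wave `e^{i(k n - ω(k) m)}` solves the linear part of the equation. -/
def IsDispersionRelation (P : Coeffs) (ω : ℝ → ℝ) : Prop :=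
  Differentiable ℝ ω ∧ ∀ k : ℝ, linSymbol P (waveK k) (waveΩ ω k) = 0

/-! ### The multiscale expansion up to order `ε³` -/

/-- The slow variables `(n₁, m₁, m₂)`. The slow times `m₃, m₄, …` do not occur
up to order `ε³`. -/
abbrev Slow : Type := ℝ × ℝ × ℝ

/-- Derivative of a function of the slow variables along the direction `v`. -/
def D (v : Slow) (f : Slow → ℂ) : Slow → ℂ := fun p => fderiv ℝ f p v

/-- `∂/∂n₁` -/
def δn₁ : (Slow → ℂ) → Slow → ℂ := D (1, 0, 0)

/-- `∂/∂m₁` -/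
def δm₁ : (Slow → ℂ) → Slow → ℂ := D (0, 1, 0)

/-- `∂/∂m₂` -/
def δm₂ : (Slow → ℂ) → Slow → ℂ := D (0, 0, 1)

/-- The operator multiplying `εⁱ` in the Taylor expansion of
`f (n₁ + s ε, m₁ + t ε, m₂ + t ε²)`, for `i ≤ 2`. For `(s, t) = (1,0), (0,1), (1,1)` these are
the operators `𝒜ᵢ, ℬᵢ, 𝒞ᵢ` describing the shifts `n → n+1`, `m → m+1` and both.
Only the orders `i ≤ 2` enter below. -/
def shiftOp (s t : ℕ) : ℕ → (Slow → ℂ) → Slow → ℂ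
  | 0, f => f
  | 1, f => fun p => (s : ℂ) * δn₁ f p + (t : ℂ) * δm₁ f p
  | 2, f => fun p =>
      (1 / 2 : ℂ) * ((s : ℂ) * δn₁ (fun q => (s : ℂ) * δn₁ f q + (t : ℂ) * δm₁ f q) p
        + (t : ℂ) * δm₁ (fun q => (s : ℂ) * δn₁ f q + (t : ℂ) * δm₁ f q) p)
      + (t : ℂ) * δm₂ f p
  | _ + 3, _ => 0

/-- The expansion of `u_{n+s,m+t}` (`s, t ∈ {0,1}`) up to order `ε³`, at the slow point `p`:
a power series in `ε` whose coefficients are Laurent polynomials in the harmonic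
`T = Kⁿ Ωᵐ`. Here `u ℓ α` is the amplitude `u_ℓ^{(α)}`, `|α| ≤ ℓ`, and
`u_{n,m} = ∑_{ℓ ≥ 1} ε^ℓ ∑_{|α| ≤ ℓ} K^{αn} Ω^{αm} u_ℓ^{(α)}`. -/
def field (ω : ℝ → ℝ) (κ : ℝ) (u : ℕ → ℤ → Slow → ℂ) (s t : ℕ) (p : Slow) :
    PowerSeries ℂ[T;T⁻¹] :=
  PowerSeries.mk fun ℓ =>
    if ℓ ≤ 3 then
      ∑ α ∈ Finset.Icc (-(ℓ : ℤ)) (ℓ : ℤ),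
        LaurentPolynomial.C (waveK κ ^ ((s : ℤ) * α) * waveΩ ω κ ^ ((t : ℤ) * α) *
          ∑ j ∈ Finset.Icc (max 1 α.natAbs) ℓ, shiftOp s t (ℓ - j) (u j α) p)
          * LaurentPolynomial.T α
    else 0

/-- `𝒲_j^{(α)}`, for `j ≤ 3`: the coefficient of `ε^j K^{αn} Ω^{αm}` in `Q⁺` after
substitution of the multiscale expansion. -/
def W (P : Coeffs) (ω : ℝ → ℝ) (κ : ℝ) (u : ℕ → ℤ → Slow → ℂ) (j : ℕ) (α : ℤ)
    (p : Slow) : ℂ :=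
  (PowerSeries.coeff j
    (Q P (field ω κ u 0 0 p) (field ω κ u 1 0 p) (field ω κ u 0 1 p) (field ω κ u 1 1 p))).coeff α

/-- Admissible families of amplitudes: smooth bounded functions of the slow variables, with
`u_ℓ^{(-α)}` conjugate to `u_ℓ^{(α)}` (the solution is real), which depend on `n₁` and `m₁` only
through `ξ = n₁ - ω'(κ) m₁`. -/
structure IsAmplitudeFamily (ω : ℝ → ℝ) (κ : ℝ) (u : ℕ → ℤ → Slow → ℂ) : Prop where
  smooth : ∀ ℓ α, ContDiff ℝ (⊤ : ℕ∞) (u ℓ α)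
  bounded : ∀ ℓ α, ∃ M : ℝ, ∀ p, ‖u ℓ α p‖ ≤ M
  real : ∀ ℓ α p, u ℓ (-α) p = conj (u ℓ α p)
  travelling : ∀ ℓ α n₁ m₁ m₂, u ℓ α (n₁, m₁, m₂) = u ℓ α (n₁ - deriv ω κ * m₁, 0, m₂)

/-- At the wave number `κ` the multiscale reduction of `Q⁺` at order `ε³` is the nonlinear
Schrödinger equation `i ∂_{m₂} u + ρ₁ ∂_ξ² u + ρ₂ u |u|² = 0` for `u = u₁^{(1)}`: modulo the
equations of order `ε` and `ε²`, the expression `𝒲₃^{(1)}` is a nonzero constant multiple of the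
left-hand side. On functions of `(ξ, m₂)` the derivative `∂_ξ` is `∂_{n₁}`. -/
def ReducesToNLS (P : Coeffs) (ω : ℝ → ℝ) (κ : ℝ) (ρ₁ ρ₂ : ℂ) : Prop :=
  ∃ c : ℂ, c ≠ 0 ∧ ∀ u : ℕ → ℤ → Slow → ℂ, IsAmplitudeFamily ω κ u →
    (∀ α p, W P ω κ u 1 α p = 0) → (∀ α p, W P ω κ u 2 α p = 0) →
    ∀ p, W P ω κ u 3 1 p =
      c * (Complex.I * δm₂ (u 1 1) p + ρ₁ * δn₁ (δn₁ (u 1 1)) p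
        + ρ₂ * (u 1 1 p * (‖u 1 1 p‖ : ℂ) ^ 2))

/-- Wave numbers at which the expansion is nondegenerate: `sin κ ≠ 0` (otherwise the dispersion
coefficient `ω''(κ)/2` vanishes) and the second harmonic is not itself a linear wave, so that
`u₂^{(2)}` is determined by `u₁^{(1)}`. -/
def IsNonresonant (P : Coeffs) (ω : ℝ → ℝ) (κ : ℝ) : Prop :=
  Real.sin κ ≠ 0 ∧ linSymbol P (waveK κ ^ 2) (waveΩ ω κ ^ 2) ≠ 0

/-- The `A₁` test: at every nonresonant wave number the reduction at order `ε³` is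
a nonlinear Schrödinger equation with real coefficients. -/
def IsA₁Integrable (P : Coeffs) : Prop :=
  ∀ ω : ℝ → ℝ, IsDispersionRelation P ω → ∀ κ : ℝ, IsNonresonant P ω κ →
    ∃ ρ₁ ρ₂ : ℝ, ReducesToNLS P ω κ ρ₁ ρ₂

/-! ### The six families -/

def S1 (P : Coeffs) : Prop :=
  P.α₂ = 0 ∧ P.β₂ = 0 ∧ P.ξ₁ = P.ξ₂ ∧ P.ξ₃ = P.ξ₄

def S2 (P : Coeffs) : Prop :=
  P.α₂ = P.β₂ ∧ P.α₁ = P.β₁ ∧ P.a₁ = 2 * P.a₂ ∧ P.γ₁ = 2 * P.γ₂ ∧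
    P.a₁ * (P.ξ₁ - P.ξ₂) = -2 * P.α₂ * P.γ₂ ∧
    -P.a₁ * (P.ξ₃ - P.ξ₄) = -2 * P.α₂ * P.γ₂

def S3 (P : Coeffs) : Prop :=
  P.α₂ = -P.β₂ ∧ P.α₁ = P.β₁ ∧ P.a₂ = 2 * P.a₁ ∧ P.γ₂ = 2 * P.γ₁ ∧
    P.a₁ * (P.ξ₁ - P.ξ₂) = -P.α₂ * P.γ₁ ∧
    P.a₁ * (P.ξ₃ - P.ξ₄) = -P.α₂ * P.γ₁

def S4 (P : Coeffs) : Prop :=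
  P.a₂ * P.α₁ = (P.a₁ + P.a₂) * P.γ₂ / 2 ∧ P.a₂ * P.β₁ = (P.a₁ + P.a₂) * P.γ₂ / 2 ∧
    P.a₂ * P.γ₁ = P.a₁ * P.γ₂ ∧
    P.a₁ * (P.ξ₁ - P.ξ₂) = -P.α₂ * P.γ₁ ∧
    P.a₁ * (P.ξ₃ - P.ξ₄) = P.β₂ * P.γ₁

def S5 (P : Coeffs) : Prop :=
  (P.a₂ - P.a₁) * P.β₂ = (P.a₂ + P.a₁) * P.α₂ ∧
    2 * P.a₁ * P.a₂ * (P.a₁ - P.a₂) * P.α₁ =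
      (P.a₁ + P.a₂) * (P.γ₂ * P.a₁ ^ 2 - P.γ₁ * P.a₂ ^ 2) ∧
    2 * P.a₁ * P.a₂ * P.β₁ = P.γ₁ * P.a₂ ^ 2 + P.γ₂ * P.a₁ ^ 2 ∧
    (P.a₂ - P.a₁) * (P.ξ₁ - P.ξ₂) = (P.γ₁ - P.γ₂) * P.α₂ ∧
    (P.a₂ - P.a₁) ^ 2 * (P.ξ₃ - P.ξ₄) =
      (P.γ₂ * (P.a₂ - 3 * P.a₁) - P.γ₁ * (P.a₁ - 3 * P.a₂)) * P.α₂

def S6 (P : Coeffs) : Prop :=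
  (P.a₂ + P.a₁) * P.β₂ = (P.a₂ - P.a₁) * P.α₂ ∧
    2 * P.a₁ * P.a₂ * P.α₁ = P.γ₁ * P.a₂ ^ 2 + P.γ₂ * P.a₁ ^ 2 ∧
    2 * P.a₁ * P.a₂ * (P.a₁ - P.a₂) * P.β₁ =
      (P.a₁ + P.a₂) * (P.γ₂ * P.a₁ ^ 2 - P.γ₁ * P.a₂ ^ 2) ∧
    (P.a₂ ^ 2 - P.a₁ ^ 2) * (P.ξ₁ - P.ξ₂) =
      (P.γ₁ * (P.a₁ - 3 * P.a₂) - P.γ₂ * (P.a₂ - 3 * P.a₁)) * P.α₂ ∧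
    (P.a₁ + P.a₂) * (P.ξ₃ - P.ξ₄) = (P.γ₂ - P.γ₁) * P.α₂

end QPlus

end

/-! The proof is by contraposition: if all NLSE coefficients are real, the equation lies in one of
the six families. Only the reality of `ρ₂`, along one dispersion relation and for `κ` in `(0, π)`,
is used.

Reduction. At order `ε` the mean `u_1^{(0)}` vanishes because `a₁ + a₂ ≠ 0`. At order `ε²` the
harmonics `0` and `2` of `u_2` are quadratic in the first harmonic, while the harmonics `±1` impose
nothing, since `ω'` is the group velocity. Substituting in `𝒲₃^{(1)}` gives an NLSE whose `ρ₂`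
collects the direct cubic interaction and the ones mediated by the second harmonic and by the mean
field (`reducesToNLS`). Plane waves show that the coefficients are unique (`ReducesToNLS.unique`),
so a real pair supplied by the test must have this `ρ₂`.

Imaginary part. Write `a₁ = l (r + 1)`, `a₂ = l (r - 1)`, `t = tan (κ/2)`. Then `K = (1 + it)/(1 -
it)` and the dispersion relation becomes `Ω = (t + ir)/(t - ir)`. The numerator and the denominator
of `ρ₂` share a phase; after it cancels, reality of `ρ₂` says that a polynomial of degree at most 5
in `t²` vanishes (`imaginaryPart_eq_zero`, `imaginaryPart_eq_sum_imCoeff`). This holds for all `t >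
0` off the resonances, so its six coefficients are zero.

Algebra. The two extreme coefficients determine `ξ₁ - ξ₂` and `ξ₃ - ξ₄`. The other four become
linear equations in three combinations of `α₁, β₁, γ₁, γ₂`, with coefficients linear in `α₂, β₂`; a
case analysis on their determinants yields (S1)–(S6) (`mem_families_of_imCoeff_eq_zero`). -/

noncomputable section

namespace QPlus

/-! ### The equation at orders one, two and three in `ε`, harmonic by harmonic -/

section Expansion

/-! ### Coefficients of products of truncated expansions -/

section PowerSeriesCoeff

variable {R : Type*} [CommRing R] {f g h k : PowerSeries R}

lemma coeff_one_mul_of_coeff_zero (hf : PowerSeries.coeff 0 f = 0)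
    (hg : PowerSeries.coeff 0 g = 0) : PowerSeries.coeff 1 (f * g) = 0 := by
  rw [PowerSeries.coeff_mul, Finset.Nat.sum_antidiagonal_eq_sum_range_succ_mk]
  simp [Finset.sum_range_succ, hf, hg]

lemma coeff_two_mul_of_coeff_zero (hf : PowerSeries.coeff 0 f = 0)
    (hg : PowerSeries.coeff 0 g = 0) :
    PowerSeries.coeff 2 (f * g) = PowerSeries.coeff 1 f * PowerSeries.coeff 1 g := by
  rw [PowerSeries.coeff_mul, Finset.Nat.sum_antidiagonal_eq_sum_range_succ_mk]
  simp only [Finset.sum_range_succ, Finset.sum_range_zero, Nat.sub_self, Nat.sub_zero, hf, hg]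
  simp

lemma coeff_three_mul_of_coeff_zero (hf : PowerSeries.coeff 0 f = 0)
    (hg : PowerSeries.coeff 0 g = 0) :
    PowerSeries.coeff 3 (f * g) = PowerSeries.coeff 1 f * PowerSeries.coeff 2 g
      + PowerSeries.coeff 2 f * PowerSeries.coeff 1 g := by
  rw [PowerSeries.coeff_mul, Finset.Nat.sum_antidiagonal_eq_sum_range_succ_mk]
  simp only [Finset.sum_range_succ, Finset.sum_range_zero, Nat.sub_self, Nat.sub_zero, hf, hg]
  simp

lemma coeff_zero_mul_of_coeff_zero (hf : PowerSeries.coeff 0 f = 0) :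
    PowerSeries.coeff 0 (f * g) = 0 := by
  rw [PowerSeries.coeff_mul, Finset.Nat.sum_antidiagonal_eq_sum_range_succ_mk]
  simp [hf]

end PowerSeriesCoeff

/-- The Laurent polynomial `∑_{|α| ≤ N} c α T^α`. -/
def harmonics (N : ℕ) (c : ℤ → ℂ) : ℂ[T;T⁻¹] :=
  ∑ α ∈ Finset.Icc (-(N : ℤ)) (N : ℤ), AddMonoidAlgebra.single α (c α)

lemma coeff_harmonics (N : ℕ) (c : ℤ → ℂ) (γ : ℤ) :
    (harmonics N c).coeff γ = ∑ α ∈ Finset.Icc (-(N : ℤ)) (N : ℤ), if α = γ then c α else 0 := by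
  simp [harmonics, AddMonoidAlgebra.coeff_sum, Finsupp.finsetSum_apply, Finsupp.single_apply,
    -LaurentPolynomial.single_eq_C_mul_T]

lemma coeff_harmonics_mul (M N : ℕ) (c d : ℤ → ℂ) (γ : ℤ) :
    (harmonics M c * harmonics N d).coeff γ =
      ∑ α ∈ Finset.Icc (-(M : ℤ)) (M : ℤ), ∑ β ∈ Finset.Icc (-(N : ℤ)) (N : ℤ),
        if α + β = γ then c α * d β else 0 := by
  simp [← ite_and, harmonics, Finset.sum_mul_sum, AddMonoidAlgebra.single_mul_single,
    AddMonoidAlgebra.coeff_sum, Finsupp.finsetSum_apply, Finsupp.single_apply,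
    -LaurentPolynomial.single_eq_C_mul_T]

lemma coeff_harmonics_mul_mul (L M N : ℕ) (b c d : ℤ → ℂ) (γ : ℤ) :
    (harmonics L b * harmonics M c * harmonics N d).coeff γ =
      ∑ α ∈ Finset.Icc (-(L : ℤ)) (L : ℤ), ∑ β ∈ Finset.Icc (-(M : ℤ)) (M : ℤ),
        ∑ δ ∈ Finset.Icc (-(N : ℤ)) (N : ℤ),
          if α + β + δ = γ then b α * c β * d δ else 0 := by
  rw [harmonics, harmonics, harmonics, Finset.sum_mul_sum, Finset.sum_mul]
  simp [← ite_and, Finset.sum_mul_sum, AddMonoidAlgebra.single_mul_single,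
    AddMonoidAlgebra.coeff_sum, Finsupp.finsetSum_apply, Finsupp.single_apply,
    -LaurentPolynomial.single_eq_C_mul_T]

lemma Icc_one : Finset.Icc (-((1 : ℕ) : ℤ)) ((1 : ℕ) : ℤ) = {-1, 0, 1} := by decide

lemma Icc_two : Finset.Icc (-((2 : ℕ) : ℤ)) ((2 : ℕ) : ℤ) = {-2, -1, 0, 1, 2} := by decide

lemma coeff_harmonics_of_mem {N : ℕ} {γ : ℤ} (h : γ ∈ Finset.Icc (-(N : ℤ)) (N : ℤ))
    (c : ℤ → ℂ) : (harmonics N c).coeff γ = c γ := by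
  rw [coeff_harmonics, Finset.sum_ite_eq' , if_pos h]

lemma coeff_harmonics_of_notMem {N : ℕ} {γ : ℤ} (h : γ ∉ Finset.Icc (-(N : ℤ)) (N : ℤ))
    (c : ℤ → ℂ) : (harmonics N c).coeff γ = 0 := by
  rw [coeff_harmonics, Finset.sum_ite_eq' , if_neg h]

lemma coeff_two_harmonics_mul (c d : ℤ → ℂ) :
    (harmonics 1 c * harmonics 1 d).coeff 2 = c 1 * d 1 := by
  rw [coeff_harmonics_mul, Icc_one]; simp

lemma coeff_neg_two_harmonics_mul (c d : ℤ → ℂ) :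
    (harmonics 1 c * harmonics 1 d).coeff (-2) = c (-1) * d (-1) := by
  rw [coeff_harmonics_mul, Icc_one]; simp

/-- Sums of two indices from `{-1, 1}` are even. This removes the quadratic part from `𝒲₂^{(±1)}`
once `u_1^{(0)} = 0`. -/
lemma coeff_one_harmonics_mul {c d : ℤ → ℂ} (hc : c 0 = 0) (hd : d 0 = 0) :
    (harmonics 1 c * harmonics 1 d).coeff 1 = 0 := by
  rw [coeff_harmonics_mul, Icc_one]; simp [hc, hd]

lemma coeff_neg_one_harmonics_mul {c d : ℤ → ℂ} (hc : c 0 = 0) (hd : d 0 = 0) :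
    (harmonics 1 c * harmonics 1 d).coeff (-1) = 0 := by
  rw [coeff_harmonics_mul, Icc_one]; simp [hc, hd]

lemma coeff_zero_harmonics_mul {c d : ℤ → ℂ} (hc : c 0 = 0) :
    (harmonics 1 c * harmonics 1 d).coeff 0 = c 1 * d (-1) + c (-1) * d 1 := by
  rw [coeff_harmonics_mul, Icc_one]; simp [hc]; ring

lemma coeff_harmonics_mul_of_two_lt {γ : ℤ} (h : 2 < |γ|) (c d : ℤ → ℂ) :
    (harmonics 1 c * harmonics 1 d).coeff γ = 0 := by
  rw [coeff_harmonics_mul]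
  refine Finset.sum_eq_zero fun α hα => Finset.sum_eq_zero fun β hβ => if_neg ?_
  rw [Finset.mem_Icc] at hα hβ
  rintro rfl
  rw [lt_abs] at h
  push_cast at *
  omega

lemma coeff_one_harmonics_mul_harmonics_two {c d : ℤ → ℂ} (hc : c 0 = 0) :
    (harmonics 1 c * harmonics 2 d).coeff 1 = c 1 * d 0 + c (-1) * d 2 := by
  rw [coeff_harmonics_mul, Icc_one, Icc_two]; simp [hc]; ring

lemma coeff_one_harmonics_mul_mul {b c d : ℤ → ℂ} (hc : c 0 = 0) (hd : d 0 = 0) :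
    (harmonics 1 b * harmonics 1 c * harmonics 1 d).coeff 1 =
      b (-1) * c 1 * d 1 + b 1 * c (-1) * d 1 + b 1 * c 1 * d (-1) := by
  rw [coeff_harmonics_mul_mul, Icc_one]; simp [hc, hd]; ring

/-! ### The expansion of the equation -/

/-- The coefficient of `ε^ℓ T^α` in the expansion of `u_{n+s,m+t}`. -/
def amp (ω : ℝ → ℝ) (κ : ℝ) (u : ℕ → ℤ → Slow → ℂ) (s t : ℕ) (p : Slow) (ℓ : ℕ) (α : ℤ) : ℂ :=
  waveK κ ^ ((s : ℤ) * α) * waveΩ ω κ ^ ((t : ℤ) * α) *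
    ∑ j ∈ Finset.Icc (max 1 α.natAbs) ℓ, shiftOp s t (ℓ - j) (u j α) p

variable (P : Coeffs) (ω : ℝ → ℝ) (κ : ℝ) (u : ℕ → ℤ → Slow → ℂ) (s t : ℕ) (p : Slow)

lemma coeff_field {ℓ : ℕ} (hℓ : ℓ ≤ 3) :
    PowerSeries.coeff ℓ (field ω κ u s t p) = harmonics ℓ (amp ω κ u s t p ℓ) := by
  simp only [field, PowerSeries.coeff_mk, if_pos hℓ, harmonics, amp,
    LaurentPolynomial.single_eq_C_mul_T]

lemma coeff_zero_field : PowerSeries.coeff 0 (field ω κ u s t p) = 0 := by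
  rw [coeff_field _ _ _ _ _ _ (by norm_num)]
  simp [harmonics, amp]

/-- The linear part of `Q⁺`. -/
def linPart (x₀₀ x₁₀ x₀₁ x₁₁ : ℂ) : ℂ := P.a₁ * (x₀₀ + x₁₁) + P.a₂ * (x₁₀ + x₀₁)

/-- The polarisation of the quadratic part of `Q⁺`, in the products of two corner values. -/
def quadPart (y : Fin 4 → Fin 4 → ℂ) : ℂ :=
  (P.α₁ - P.α₂) * y 0 1 + (P.α₁ + P.α₂) * y 2 3 + (P.β₁ - P.β₂) * y 0 2
    + (P.β₁ + P.β₂) * y 1 3 + P.γ₁ * y 0 3 + P.γ₂ * y 1 2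

/-- The polarisation of the cubic part of `Q⁺`, in the products of three corner values. -/
def cubPart (y : Fin 4 → Fin 4 → Fin 4 → ℂ) : ℂ :=
  (P.ξ₁ - P.ξ₃) * y 0 1 2 + (P.ξ₁ + P.ξ₃) * y 0 1 3 + (P.ξ₂ - P.ξ₄) * y 1 2 3
    + (P.ξ₂ + P.ξ₄) * y 0 2 3

/-- The amplitudes at the four corners `(0,0), (1,0), (0,1), (1,1)`. -/
def corner (ℓ : ℕ) (i : Fin 4) : ℤ → ℂ :=
  amp ω κ u (![0, 1, 0, 1] i) (![0, 0, 1, 1] i) p ℓ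

lemma W_one (α : ℤ) :
    W P ω κ u 1 α p = linPart P ((harmonics 1 (corner ω κ u p 1 0)).coeff α)
      ((harmonics 1 (corner ω κ u p 1 1)).coeff α) ((harmonics 1 (corner ω κ u p 1 2)).coeff α)
      ((harmonics 1 (corner ω κ u p 1 3)).coeff α) := by
  have h0 := fun s t => coeff_zero_field ω κ u s t p
  have h2 := fun s t s' t' =>
    coeff_zero_mul_of_coeff_zero (g := field ω κ u s' t' p) (h0 s t)
  have h3 := fun s t s' t' s'' t'' =>
    coeff_zero_mul_of_coeff_zero (g := field ω κ u s'' t'' p) (h2 s t s' t')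
  have e := fun (s t : ℕ) => coeff_field ω κ u s t p (show 1 ≤ 3 by norm_num)
  simp only [W, Q, map_add, PowerSeries.coeff_smul, coeff_one_mul_of_coeff_zero, h0,
    h2, h3, smul_zero, add_zero, e]
  simp [linPart, corner]
  ring

lemma W_two (α : ℤ) :
    W P ω κ u 2 α p = linPart P ((harmonics 2 (corner ω κ u p 2 0)).coeff α)
      ((harmonics 2 (corner ω κ u p 2 1)).coeff α) ((harmonics 2 (corner ω κ u p 2 2)).coeff α)
      ((harmonics 2 (corner ω κ u p 2 3)).coeff α)
      + quadPart P fun i j =>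
        (harmonics 1 (corner ω κ u p 1 i) * harmonics 1 (corner ω κ u p 1 j)).coeff α := by
  have h0 := fun s t => coeff_zero_field ω κ u s t p
  have h2 := fun s t s' t' =>
    coeff_zero_mul_of_coeff_zero (g := field ω κ u s' t' p) (h0 s t)
  have h3 := fun s t s' t' s'' t'' =>
    coeff_zero_mul_of_coeff_zero (g := field ω κ u s'' t'' p) (h2 s t s' t')
  have e := fun (s t : ℕ) => coeff_field ω κ u s t p (show 1 ≤ 3 by norm_num)
  have e2 := fun (s t : ℕ) => coeff_field ω κ u s t p (show 2 ≤ 3 by norm_num)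
  simp only [W, Q, map_add, PowerSeries.coeff_smul, coeff_one_mul_of_coeff_zero,
    coeff_two_mul_of_coeff_zero, h0,
    h2, h3, smul_zero, add_zero, zero_mul, e, e2]
  simp [linPart, quadPart, corner]
  ring

/-- Every field starts at order `ε`, so a monomial of degree `d` first contributes at order `ε^d`;
the quartic coefficient `ζ` therefore never enters. -/
lemma W_three (α : ℤ) :
    W P ω κ u 3 α p = linPart P ((harmonics 3 (corner ω κ u p 3 0)).coeff α)
      ((harmonics 3 (corner ω κ u p 3 1)).coeff α) ((harmonics 3 (corner ω κ u p 3 2)).coeff α)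
      ((harmonics 3 (corner ω κ u p 3 3)).coeff α)
      + quadPart P (fun i j =>
        (harmonics 1 (corner ω κ u p 1 i) * harmonics 2 (corner ω κ u p 2 j)).coeff α
        + (harmonics 2 (corner ω κ u p 2 i) * harmonics 1 (corner ω κ u p 1 j)).coeff α)
      + cubPart P fun i j k =>
        (harmonics 1 (corner ω κ u p 1 i) * harmonics 1 (corner ω κ u p 1 j) *
          harmonics 1 (corner ω κ u p 1 k)).coeff α := by
  have h0 := fun s t => coeff_zero_field ω κ u s t p
  have h2 := fun s t s' t' =>
    coeff_zero_mul_of_coeff_zero (g := field ω κ u s' t' p) (h0 s t)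
  have h3 := fun s t s' t' s'' t'' =>
    coeff_zero_mul_of_coeff_zero (g := field ω κ u s'' t'' p) (h2 s t s' t')
  have e := fun (s t : ℕ) => coeff_field ω κ u s t p (show 1 ≤ 3 by norm_num)
  have e2 := fun (s t : ℕ) => coeff_field ω κ u s t p (show 2 ≤ 3 by norm_num)
  have e3 := fun (s t : ℕ) => coeff_field ω κ u s t p (show 3 ≤ 3 by norm_num)
  simp only [W, Q, map_add, PowerSeries.coeff_smul, coeff_one_mul_of_coeff_zero,
    coeff_two_mul_of_coeff_zero, coeff_three_mul_of_coeff_zero, h0,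
    h2, h3, smul_zero, add_zero, zero_add, zero_mul, e, e2, e3]
  simp [linPart, quadPart, cubPart, corner]
  ring

end Expansion

/-! ### Symbols of the harmonics for amplitudes in the travelling frame -/

section OrderEquations

/-! ### Functions of the travelling variable -/

/-- The projection `(n₁, m₁, m₂) ↦ (n₁ - v m₁, 0, m₂)`. -/
def toFrame (v : ℝ) : Slow →L[ℝ] Slow :=
  (ContinuousLinearMap.fst ℝ ℝ (ℝ × ℝ)
      - v • (ContinuousLinearMap.fst ℝ ℝ ℝ).comp (ContinuousLinearMap.snd ℝ ℝ (ℝ × ℝ))).prod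
    ((0 : Slow →L[ℝ] ℝ).prod
      ((ContinuousLinearMap.snd ℝ ℝ ℝ).comp (ContinuousLinearMap.snd ℝ ℝ (ℝ × ℝ))))

lemma toFrame_apply (v : ℝ) (p : Slow) : toFrame v p = (p.1 - v * p.2.1, 0, p.2.2) := by
  simp [toFrame]

/-- `f` depends on `n₁, m₁` only through `n₁ - v m₁`. -/
def IsTravelling (v : ℝ) (f : Slow → ℂ) : Prop := ∀ p, f p = f (toFrame v p)

section Travelling

variable {v : ℝ} {f : Slow → ℂ}

lemma IsTravelling.D_eq (h : IsTravelling v f) (hf : Differentiable ℝ f) (w p : Slow) :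
    D w f p = D (toFrame v w) f (toFrame v p) := by
  have e : f = f ∘ toFrame v := funext h
  have h1 : fderiv ℝ f p = (fderiv ℝ f (toFrame v p)).comp (toFrame v) := by
    conv_lhs => rw [e]
    rw [fderiv_comp p (hf _) (toFrame v).differentiableAt, ContinuousLinearMap.fderiv]
  simp only [D, h1, ContinuousLinearMap.comp_apply]

lemma IsTravelling.δn₁ (h : IsTravelling v f) (hf : Differentiable ℝ f) :
    IsTravelling v (QPlus.δn₁ f) := by
  intro p
  have := h.D_eq hf (1, 0, 0) p
  rw [toFrame_apply v (1, 0, 0)] at this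
  simpa [QPlus.δn₁] using this

lemma IsTravelling.δm₁_eq (h : IsTravelling v f) (hf : Differentiable ℝ f) (p : Slow) :
    δm₁ f p = -v * QPlus.δn₁ f p := by
  have h1 : δm₁ f p = D (-v, 0, 0) f (toFrame v p) := by
    have := h.D_eq hf (0, 1, 0) p
    rw [toFrame_apply v (0, 1, 0)] at this
    simpa [δm₁] using this
  have h2 : ((-v, 0, 0) : Slow) = (-v) • (1, 0, 0) := by simp
  rw [h1, h.δn₁ hf p, h2]
  simp only [D, QPlus.δn₁, map_smul]
  simp

lemma contDiff_D (hf : ContDiff ℝ (⊤ : ℕ∞) f) (w : Slow) : ContDiff ℝ (⊤ : ℕ∞) (D w f) :=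
  (hf.fderiv_right (m := (⊤ : ℕ∞)) (by simp)).clm_apply contDiff_const

lemma differentiable_of_smooth (hf : ContDiff ℝ (⊤ : ℕ∞) f) : Differentiable ℝ f :=
  hf.differentiable (by simp)

lemma D_const_mul (hf : Differentiable ℝ f) (c : ℂ) (w p : Slow) :
    D w (fun q => c * f q) p = c * D w f p := by
  simp [D, fderiv_const_mul (hf p)]

/-- On travelling functions `∂_{m₁} = -v ∂_{n₁}`, so a lattice shift by `(s, t)` moves `ξ` by `ε (s
- t v)`. -/
lemma shiftOp_one_eq (h : IsTravelling v f) (hf : Differentiable ℝ f) (s t : ℕ) (p : Slow) :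
    shiftOp s t 1 f p = (s - t * v) * δn₁ f p := by
  simp only [shiftOp, h.δm₁_eq hf]
  ring

lemma shiftOp_two_eq (h : IsTravelling v f) (hf : ContDiff ℝ (⊤ : ℕ∞) f) (s t : ℕ) (p : Slow) :
    shiftOp s t 2 f p = 1 / 2 * (s - t * v) ^ 2 * δn₁ (δn₁ f) p + t * δm₂ f p := by
  have hd := differentiable_of_smooth hf
  have hd' : Differentiable ℝ (δn₁ f) := differentiable_of_smooth (contDiff_D hf _)
  have e : (fun q => (s : ℂ) * δn₁ f q + (t : ℂ) * δm₁ f q)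
      = fun q => ((s : ℂ) - t * v) * δn₁ f q := by
    funext q
    rw [h.δm₁_eq hd]
    ring
  have e1 : ∀ c : ℂ, δn₁ (fun q => c * δn₁ f q) p = c * δn₁ (δn₁ f) p :=
    fun c => D_const_mul hd' c _ p
  have e2 : ∀ c : ℂ, δm₁ (fun q => c * δn₁ f q) p = c * δm₁ (δn₁ f) p :=
    fun c => D_const_mul hd' c _ p
  simp only [shiftOp]
  rw [e, e1, e2, (h.δn₁ hd).δm₁_eq hd']
  ring

end Travelling

/-! ### The equations of order `ε`, `ε²`, `ε³` -/

variable {P : Coeffs} {ω : ℝ → ℝ} {κ : ℝ} {u : ℕ → ℤ → Slow → ℂ}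

lemma waveK_ne_zero (κ : ℝ) : waveK κ ≠ 0 := Complex.exp_ne_zero _

lemma waveΩ_ne_zero (ω : ℝ → ℝ) (κ : ℝ) : waveΩ ω κ ≠ 0 := Complex.exp_ne_zero _

lemma IsAmplitudeFamily.isTravelling (h : IsAmplitudeFamily ω κ u) (ℓ : ℕ) (α : ℤ) :
    IsTravelling (deriv ω κ) (u ℓ α) := by
  rintro ⟨n, m, l⟩
  rw [h.travelling, toFrame_apply]

lemma IsAmplitudeFamily.differentiable (h : IsAmplitudeFamily ω κ u) (ℓ : ℕ) (α : ℤ) :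
    Differentiable ℝ (u ℓ α) := differentiable_of_smooth (h.smooth ℓ α)

/-- The symbol generating the second harmonic. -/
def symbol₁₁ (P : Coeffs) (K Ω : ℂ) : ℂ :=
  (P.α₁ - P.α₂) * K + (P.α₁ + P.α₂) * (K * Ω ^ 2) + (P.β₁ - P.β₂) * Ω
    + (P.β₁ + P.β₂) * (K ^ 2 * Ω) + (P.γ₁ + P.γ₂) * (K * Ω)

/-- The symbol generating the mean field. -/
def symbolMean (P : Coeffs) (K Ω : ℂ) : ℂ :=
  2 * P.α₁ * (K + K⁻¹) + 2 * P.β₁ * (Ω + Ω⁻¹) + P.γ₁ * (K * Ω + K⁻¹ * Ω⁻¹)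
    + P.γ₂ * (K * Ω⁻¹ + K⁻¹ * Ω)

/-- The symbol of the interaction of the mean field with the first harmonic. -/
def symbol₀₁ (P : Coeffs) (K Ω : ℂ) : ℂ :=
  (P.α₁ - P.α₂) * (1 + K) + (P.α₁ + P.α₂) * (Ω + K * Ω) + (P.β₁ - P.β₂) * (1 + Ω)
    + (P.β₁ + P.β₂) * (K + K * Ω) + P.γ₁ * (1 + K * Ω) + P.γ₂ * (K + Ω)

/-- The symbol of the interaction of the harmonics `2` and `-1`. -/
def symbol₂₁ (P : Coeffs) (K Ω : ℂ) : ℂ :=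
  (P.α₁ - P.α₂) * (K ^ 2 + K⁻¹) + (P.α₁ + P.α₂) * (K ^ 2 * Ω + K⁻¹ * Ω)
    + (P.β₁ - P.β₂) * (Ω ^ 2 + Ω⁻¹) + (P.β₁ + P.β₂) * (K * Ω ^ 2 + K * Ω⁻¹)
    + P.γ₁ * (K ^ 2 * Ω ^ 2 + K⁻¹ * Ω⁻¹) + P.γ₂ * (K⁻¹ * Ω ^ 2 + K ^ 2 * Ω⁻¹)

/-- The symbol of the cubic self-interaction of the first harmonic. -/
def symbolCubic (P : Coeffs) (K Ω : ℂ) : ℂ :=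
  (P.ξ₁ - P.ξ₃) * (K * Ω + K⁻¹ * Ω + K * Ω⁻¹) + (P.ξ₁ + P.ξ₃) * (K ^ 2 * Ω + Ω + Ω⁻¹)
    + (P.ξ₂ - P.ξ₄) * (Ω ^ 2 + K ^ 2 + 1) + (P.ξ₂ + P.ξ₄) * (K * Ω ^ 2 + K + K⁻¹)

/-- The symbol of the transport operator `∂_{m₁} + ω'(κ) ∂_{n₁}` of order `ε²`. -/
def symbolDrift (P : Coeffs) (K Ω : ℂ) (v : ℝ) : ℂ :=
  P.a₁ * (K * Ω) * (1 - v) + P.a₂ * (K - v * Ω)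

variable (κ u) in
lemma corner_one_apply (ω : ℝ → ℝ) (p : Slow) (i : Fin 4) {α : ℤ} (hα : α.natAbs ≤ 1) :
    corner ω κ u p 1 i α = ![1, waveK κ ^ α, waveΩ ω κ ^ α, waveK κ ^ α * waveΩ ω κ ^ α] i
      * u 1 α p := by
  fin_cases i <;> simp [corner, amp, hα, shiftOp]

lemma corner_two_zero (p : Slow) (i : Fin 4) (h0 : u 1 0 = 0) :
    corner ω κ u p 2 i 0 = u 2 0 p := by
  have e : Finset.Icc 1 2 = {1, 2} := by decide
  have z : ∀ w q, D w (0 : Slow → ℂ) q = 0 := fun w q => by simp [D]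
  fin_cases i <;> simp [corner, amp, shiftOp, e, h0, δn₁, δm₁, z]

lemma corner_two_of_natAbs_eq_two (p : Slow) (i : Fin 4) {α : ℤ} (hα : α.natAbs = 2) :
    corner ω κ u p 2 i α = ![1, waveK κ ^ α, waveΩ ω κ ^ α, waveK κ ^ α * waveΩ ω κ ^ α] i
      * u 2 α p := by
  fin_cases i <;> simp [corner, amp, hα, shiftOp]

lemma corner_two_of_natAbs_eq_one (h : IsAmplitudeFamily ω κ u) (p : Slow) (i : Fin 4) {α : ℤ}
    (hα : α.natAbs = 1) :
    corner ω κ u p 2 i α = ![1, waveK κ ^ α, waveΩ ω κ ^ α, waveK κ ^ α * waveΩ ω κ ^ α] i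
      * (u 2 α p + (![0, 1, 0, 1] i - ![0, 0, 1, 1] i * ((deriv ω κ : ℝ) : ℂ)) * δn₁ (u 1 α) p) := by
  have e : Finset.Icc 1 2 = {1, 2} := by decide
  have e0 : ∀ s t f, shiftOp s t 0 f = f := fun _ _ _ => rfl
  have e1 := fun s t => shiftOp_one_eq (h.isTravelling 1 α) (h.differentiable 1 α) s t p
  fin_cases i <;> simp [corner, amp, hα, e, e0, e1, -mul_eq_mul_left_iff] <;> ring

lemma corner_three_one (h : IsAmplitudeFamily ω κ u) (p : Slow) (i : Fin 4) :
    corner ω κ u p 3 i 1 = ![1, waveK κ, waveΩ ω κ, waveK κ * waveΩ ω κ] i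
      * (u 3 1 p + (![0, 1, 0, 1] i - ![0, 0, 1, 1] i * ((deriv ω κ : ℝ) : ℂ)) * δn₁ (u 2 1) p
        + (1 / 2 * (![0, 1, 0, 1] i - ![0, 0, 1, 1] i * ((deriv ω κ : ℝ) : ℂ)) ^ 2
            * δn₁ (δn₁ (u 1 1)) p + ![0, 0, 1, 1] i * δm₂ (u 1 1) p)) := by
  have e : Finset.Icc 1 3 = {1, 2, 3} := by decide
  have e0 : ∀ s t f, shiftOp s t 0 f = f := fun _ _ _ => rfl
  have e1 := fun s t => shiftOp_one_eq (h.isTravelling 2 1) (h.differentiable 2 1) s t p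
  have e2 := fun s t => shiftOp_two_eq (h.isTravelling 1 1) (h.smooth 1 1) s t p
  fin_cases i <;> simp [corner, amp, e, e0, e1, e2, -mul_eq_mul_left_iff] <;> ring

lemma W_one_apply (p : Slow) {α : ℤ} (hα : α.natAbs ≤ 1) :
    W P ω κ u 1 α p = linSymbol P (waveK κ ^ α) (waveΩ ω κ ^ α) * u 1 α p := by
  have hm : α ∈ Finset.Icc (-((1 : ℕ) : ℤ)) ((1 : ℕ) : ℤ) := by
    rw [Finset.mem_Icc]; push_cast; omega
  simp only [W_one, coeff_harmonics_of_mem hm, corner_one_apply κ u ω p _ hα]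
  simp [linPart, linSymbol]
  ring

lemma W_one_of_one_lt (p : Slow) {α : ℤ} (hα : 1 < α.natAbs) : W P ω κ u 1 α p = 0 := by
  have hm : α ∉ Finset.Icc (-((1 : ℕ) : ℤ)) ((1 : ℕ) : ℤ) := by
    rw [Finset.mem_Icc]; push_cast; omega
  simp [W_one, coeff_harmonics_of_notMem hm, linPart]

lemma W_two_of_two_lt (p : Slow) {α : ℤ} (hα : 2 < α.natAbs) : W P ω κ u 2 α p = 0 := by
  have hm : α ∉ Finset.Icc (-((2 : ℕ) : ℤ)) ((2 : ℕ) : ℤ) := by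
    rw [Finset.mem_Icc]; push_cast; omega
  have hm' : 2 < |α| := by rw [Int.abs_eq_natAbs]; omega
  simp [W_two, coeff_harmonics_of_notMem hm, linPart, coeff_harmonics_mul_of_two_lt hm', quadPart]

lemma W_two_two (p : Slow) :
    W P ω κ u 2 2 p = linSymbol P (waveK κ ^ 2) (waveΩ ω κ ^ 2) * u 2 2 p
      + symbol₁₁ P (waveK κ) (waveΩ ω κ) * u 1 1 p ^ 2 := by
  have hm : (2 : ℤ) ∈ Finset.Icc (-((2 : ℕ) : ℤ)) ((2 : ℕ) : ℤ) := by decide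
  have c2 := fun i => corner_two_of_natAbs_eq_two (ω := ω) (κ := κ) (u := u) p i (α := 2) rfl
  have c1 := fun i => corner_one_apply κ u ω p i (α := 1) le_rfl
  simp only [W_two, coeff_harmonics_of_mem hm, coeff_two_harmonics_mul, c1, c2]
  simp [linPart, linSymbol, quadPart, symbol₁₁, zpow_ofNat]
  ring

lemma W_two_neg_two (p : Slow) :
    W P ω κ u 2 (-2) p = linSymbol P ((waveK κ)⁻¹ ^ 2) ((waveΩ ω κ)⁻¹ ^ 2) * u 2 (-2) p
      + symbol₁₁ P (waveK κ)⁻¹ (waveΩ ω κ)⁻¹ * u 1 (-1) p ^ 2 := by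
  have hm : (-2 : ℤ) ∈ Finset.Icc (-((2 : ℕ) : ℤ)) ((2 : ℕ) : ℤ) := by decide
  have c2 := fun i => corner_two_of_natAbs_eq_two (ω := ω) (κ := κ) (u := u) p i (α := -2) rfl
  have c1 := fun i => corner_one_apply κ u ω p i (α := -1) le_rfl
  simp only [W_two, coeff_harmonics_of_mem hm, coeff_neg_two_harmonics_mul, c1, c2]
  simp [linPart, linSymbol, quadPart, symbol₁₁, zpow_neg, zpow_ofNat]
  ring

lemma W_two_zero (p : Slow) (h0 : u 1 0 = 0) :
    W P ω κ u 2 0 p = 2 * (P.a₁ + P.a₂) * u 2 0 p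
      + symbolMean P (waveK κ) (waveΩ ω κ) * (u 1 1 p * u 1 (-1) p) := by
  have hm : (0 : ℤ) ∈ Finset.Icc (-((2 : ℕ) : ℤ)) ((2 : ℕ) : ℤ) := by decide
  have c1 := fun i => corner_one_apply κ u ω p i (α := 1) le_rfl
  have c1' := fun i => corner_one_apply κ u ω p i (α := -1) le_rfl
  have c0 : ∀ i, corner ω κ u p 1 i 0 = 0 := fun i => by
    rw [corner_one_apply κ u ω p i (by decide), h0]; simp
  have hK := waveK_ne_zero κ
  have hΩ := waveΩ_ne_zero ω κ
  simp only [W_two, coeff_harmonics_of_mem hm, coeff_zero_harmonics_mul (c0 _), c1, c1',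
    corner_two_zero p _ h0]
  simp [linPart, quadPart, symbolMean, zpow_neg]
  field_simp
  ring

/-- Along a dispersion relation both symbols vanish, so these harmonics leave `u_1^{(±1)}` and
`u_2^{(±1)}` free. -/
lemma W_two_of_natAbs_eq_one (h : IsAmplitudeFamily ω κ u) (p : Slow) (h0 : u 1 0 = 0) {α : ℤ}
    (hα : α.natAbs = 1) :
    W P ω κ u 2 α p = linSymbol P (waveK κ ^ α) (waveΩ ω κ ^ α) * u 2 α p
      + symbolDrift P (waveK κ ^ α) (waveΩ ω κ ^ α) (deriv ω κ) * δn₁ (u 1 α) p := by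
  have hm : α ∈ Finset.Icc (-((2 : ℕ) : ℤ)) ((2 : ℕ) : ℤ) := by
    rw [Finset.mem_Icc]; push_cast; omega
  have c0 : ∀ i, corner ω κ u p 1 i 0 = 0 := fun i => by
    rw [corner_one_apply κ u ω p i (by decide), h0]; simp
  have c2 := fun i => corner_two_of_natAbs_eq_one h p i hα
  have hq : ∀ i j, (harmonics 1 (corner ω κ u p 1 i) * harmonics 1 (corner ω κ u p 1 j)).coeff α
      = 0 := fun i j => by
    rcases Int.natAbs_eq_iff.mp hα with rfl | rfl
    · exact coeff_one_harmonics_mul (c0 i) (c0 j)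
    · exact coeff_neg_one_harmonics_mul (c0 i) (c0 j)
  simp only [W_two, coeff_harmonics_of_mem hm, hq, c2]
  simp [linPart, linSymbol, quadPart, symbolDrift]
  ring

/-- The terms in `u_3^{(1)}` and `∂ u_2^{(1)}` carry symbols that vanish along a dispersion
relation. What is left involves only `u_1^{(±1)}`, `u_2^{(0)}` and `u_2^{(2)}`. -/
lemma W_three_one (h : IsAmplitudeFamily ω κ u) (p : Slow) (h0 : u 1 0 = 0) :
    W P ω κ u 3 1 p = linSymbol P (waveK κ) (waveΩ ω κ) * u 3 1 p
      + symbolDrift P (waveK κ) (waveΩ ω κ) (deriv ω κ) * δn₁ (u 2 1) p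
      + 1 / 2 * (P.a₁ * (waveK κ * waveΩ ω κ) * (1 - ((deriv ω κ : ℝ) : ℂ)) ^ 2
          + P.a₂ * (waveK κ + ((deriv ω κ : ℝ) : ℂ) ^ 2 * waveΩ ω κ)) * δn₁ (δn₁ (u 1 1)) p
      + (P.a₁ * (waveK κ * waveΩ ω κ) + P.a₂ * waveΩ ω κ) * δm₂ (u 1 1) p
      + symbol₀₁ P (waveK κ) (waveΩ ω κ) * (u 2 0 p * u 1 1 p)
      + symbol₂₁ P (waveK κ) (waveΩ ω κ) * (u 2 2 p * u 1 (-1) p)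
      + symbolCubic P (waveK κ) (waveΩ ω κ) * (u 1 1 p ^ 2 * u 1 (-1) p) := by
  have hm : (1 : ℤ) ∈ Finset.Icc (-((3 : ℕ) : ℤ)) ((3 : ℕ) : ℤ) := by decide
  have c0 : ∀ i, corner ω κ u p 1 i 0 = 0 := fun i => by
    rw [corner_one_apply κ u ω p i (by decide), h0]; simp
  have c1 := fun i => corner_one_apply κ u ω p i (α := 1) le_rfl
  have c1' := fun i => corner_one_apply κ u ω p i (α := -1) le_rfl
  have c2 := fun i => corner_two_of_natAbs_eq_two (ω := ω) (κ := κ) (u := u) p i (α := 2) rfl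
  have hq : ∀ i j, (harmonics 2 (corner ω κ u p 2 i) * harmonics 1 (corner ω κ u p 1 j)).coeff 1
      = corner ω κ u p 1 j 1 * corner ω κ u p 2 i 0
        + corner ω κ u p 1 j (-1) * corner ω κ u p 2 i 2 := fun i j => by
    rw [mul_comm, coeff_one_harmonics_mul_harmonics_two (c0 j)]
  have hK := waveK_ne_zero κ
  have hΩ := waveΩ_ne_zero ω κ
  simp only [W_three, coeff_harmonics_of_mem hm, coeff_one_harmonics_mul_harmonics_two (c0 _), hq,
    coeff_one_harmonics_mul_mul (c0 _) (c0 _), corner_three_one h, c1, c1', c2,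
    corner_two_zero p _ h0]
  simp [linPart, linSymbol, quadPart, cubPart, symbolDrift, symbol₀₁, symbol₂₁, symbolCubic,
    zpow_neg, zpow_ofNat]
  field_simp
  ring

end OrderEquations

/-! ### Reduction to the NLSE and uniqueness of its coefficients -/

section Reduction

variable {P : Coeffs} {ω : ℝ → ℝ} {κ : ℝ} {u : ℕ → ℤ → Slow → ℂ}

lemma conj_waveK (κ : ℝ) : conj (waveK κ) = (waveK κ)⁻¹ := by
  rw [waveK, ← Complex.exp_conj, ← Complex.exp_neg]
  simp

lemma conj_waveΩ (ω : ℝ → ℝ) (κ : ℝ) : conj (waveΩ ω κ) = (waveΩ ω κ)⁻¹ := by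
  rw [waveΩ, ← Complex.exp_conj, ← Complex.exp_neg]
  simp

lemma norm_waveK (κ : ℝ) : ‖waveK κ‖ = 1 := by
  rw [waveK, mul_comm, Complex.norm_exp_ofReal_mul_I]

lemma conj_linSymbol (P : Coeffs) (K Ω : ℂ) :
    conj (linSymbol P K Ω) = linSymbol P (conj K) (conj Ω) := by
  simp [linSymbol]

lemma conj_symbol₁₁ (P : Coeffs) (K Ω : ℂ) :
    conj (symbol₁₁ P K Ω) = symbol₁₁ P (conj K) (conj Ω) := by
  simp [symbol₁₁]

lemma conj_symbolMean (P : Coeffs) (ω : ℝ → ℝ) (κ : ℝ) :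
    conj (symbolMean P (waveK κ) (waveΩ ω κ)) = symbolMean P (waveK κ) (waveΩ ω κ) := by
  simp only [symbolMean, conj_waveK, conj_waveΩ, map_add, map_mul, map_inv₀, map_ofNat,
    Complex.conj_ofReal, inv_inv]
  ring

lemma conj_symbolDrift (P : Coeffs) (K Ω : ℂ) (v : ℝ) :
    conj (symbolDrift P K Ω v) = symbolDrift P (conj K) (conj Ω) v := by
  simp [symbolDrift]

/-- Differentiating the dispersion relation: `ω'(κ)` is the group velocity. -/
lemma IsDispersionRelation.symbolDrift_eq_zero (h : IsDispersionRelation P ω) (κ : ℝ) :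
    symbolDrift P (waveK κ) (waveΩ ω κ) (deriv ω κ) = 0 := by
  have hK : HasDerivAt waveK (waveK κ * Complex.I) κ := by
    have := ((hasDerivAt_id κ).ofReal_comp.const_mul Complex.I).cexp
    rw [Complex.ofReal_one, mul_one] at this
    exact this
  have hΩ : HasDerivAt (waveΩ ω) (waveΩ ω κ * -(Complex.I * (deriv ω κ : ℝ))) κ :=
    (((h.1 κ).hasDerivAt.ofReal_comp).const_mul Complex.I).neg.cexp
  have hd := (((hK.mul hΩ).const_add 1).const_mul (P.a₁ : ℂ)).add
    ((hK.add hΩ).const_mul (P.a₂ : ℂ))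
  have hz : HasDerivAt (fun k => (P.a₁ : ℂ) * (1 + waveK k * waveΩ ω k)
      + P.a₂ * (waveK k + waveΩ ω k)) 0 κ := by
    have e : (fun k => (P.a₁ : ℂ) * (1 + waveK k * waveΩ ω k)
      + P.a₂ * (waveK k + waveΩ ω k)) = fun _ => 0 := funext h.2
    rw [e]
    exact hasDerivAt_const _ _
  have := hd.unique hz
  -- Since `K' = iK` and `Ω' = -iω'Ω`, the derivative of the symbol along the relation is `i` times
  -- the drift symbol.
  refine (mul_eq_zero.mp (?_ : Complex.I * _ = 0)).resolve_left Complex.I_ne_zero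
  rw [symbolDrift, ← this]
  ring

/-- This is the coefficient of `∂_{m₂} u` in `𝒲₃^{(1)}`. Since `|K| = 1`, its vanishing would force
`|a₁| = |a₂|`. -/
lemma symbolTime_ne_zero (ha : |P.a₁| ≠ |P.a₂|) (ω : ℝ → ℝ) (κ : ℝ) :
    P.a₁ * (waveK κ * waveΩ ω κ) + P.a₂ * waveΩ ω κ ≠ 0 := by
  intro h
  have h1 : (P.a₁ : ℂ) * waveK κ = -P.a₂ := by
    have : ((P.a₁ : ℂ) * waveK κ + P.a₂) * waveΩ ω κ = 0 := by rw [← h]; ring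
    exact eq_neg_of_add_eq_zero_left
      ((mul_eq_zero.mp this).resolve_right (waveΩ_ne_zero ω κ))
  apply ha
  simpa [norm_waveK] using congrArg norm h1

lemma add_ne_zero_of_abs_ne {a b : ℝ} (h : |a| ≠ |b|) : a + b ≠ 0 := fun e => h <| by
  rw [eq_neg_of_add_eq_zero_left e, abs_neg]

/-- The coefficient of `u |u|²` in `𝒲₃^{(1)}`. -/
def cubicCoeff (P : Coeffs) (K Ω : ℂ) : ℂ :=
  symbolCubic P K Ω - symbol₂₁ P K Ω * symbol₁₁ P K Ω / linSymbol P (K ^ 2) (Ω ^ 2)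
    - symbol₀₁ P K Ω * symbolMean P K Ω / (2 * (P.a₁ + P.a₂))

lemma reducesToNLS (ha : |P.a₁| ≠ |P.a₂|) (hω : IsDispersionRelation P ω)
    (hκ : IsNonresonant P ω κ) :
    ∃ ρ₁ : ℂ, ReducesToNLS P ω κ ρ₁
      (cubicCoeff P (waveK κ) (waveΩ ω κ)
        / (-Complex.I * (P.a₁ * (waveK κ * waveΩ ω κ) + P.a₂ * waveΩ ω κ))) := by
  have hc : -Complex.I * (P.a₁ * (waveK κ * waveΩ ω κ) + P.a₂ * waveΩ ω κ) ≠ 0 :=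
    mul_ne_zero (neg_ne_zero.mpr Complex.I_ne_zero) (symbolTime_ne_zero ha ω κ)
  have hs : (P.a₁ : ℂ) + P.a₂ ≠ 0 := mod_cast add_ne_zero_of_abs_ne ha
  refine ⟨(1 / 2 * (P.a₁ * (waveK κ * waveΩ ω κ) * (1 - ((deriv ω κ : ℝ) : ℂ)) ^ 2
      + P.a₂ * (waveK κ + ((deriv ω κ : ℝ) : ℂ) ^ 2 * waveΩ ω κ)))
        / (-Complex.I * (P.a₁ * (waveK κ * waveΩ ω κ) + P.a₂ * waveΩ ω κ)), _, hc, ?_⟩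
  intro u hu h1 h2 p
  have h0 : u 1 0 = 0 := by
    funext q
    have := h1 0 q
    rw [W_one_apply q (by decide)] at this
    refine (mul_eq_zero.mp this).resolve_left fun h => hs ?_
    simp only [linSymbol, zpow_zero] at h
    linear_combination h / 2
  have e0 : u 2 0 p = -(symbolMean P (waveK κ) (waveΩ ω κ) * (u 1 1 p * u 1 (-1) p))
      / (2 * (P.a₁ + P.a₂)) := by
    have := h2 0 p
    rw [W_two_zero p h0] at this
    rw [eq_div_iff (mul_ne_zero two_ne_zero hs)]
    linear_combination this
  have e2 : u 2 2 p = -(symbol₁₁ P (waveK κ) (waveΩ ω κ) * u 1 1 p ^ 2)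
      / linSymbol P (waveK κ ^ 2) (waveΩ ω κ ^ 2) := by
    have := h2 2 p
    rw [W_two_two] at this
    rw [eq_div_iff hκ.2]
    linear_combination this
  have hn : (‖u 1 1 p‖ : ℂ) ^ 2 = u 1 1 p * u 1 (-1) p := by
    rw [hu.real 1 1 p, Complex.mul_conj, Complex.normSq_eq_norm_sq]
    push_cast
    rfl
  have hc' : ∀ c R N x y z : ℂ, c ≠ 0 →
      c * (x + R / c * y + N / c * z) = c * x + R * y + N * z := fun c R N x y z h => by
    field_simp
  rw [W_three_one hu p h0, hω.2 κ, hω.symbolDrift_eq_zero κ, hn, e0, e2, hc' _ _ _ _ _ _ hc,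
    cubicCoeff]
  linear_combination ((P.a₁ * (waveK κ * waveΩ ω κ) + P.a₂ * waveΩ ω κ) * δm₂ (u 1 1) p)
    * Complex.I_sq

/-! ### Plane wave amplitudes -/

/-- The amplitudes `A_ℓ^{(α)} e^{iα(p ξ + q m₂)}`, `ξ = n₁ - v m₁`. -/
def planeWave (v p q : ℝ) (A : ℕ → ℤ → ℂ) (ℓ : ℕ) (α : ℤ) (x : Slow) : ℂ :=
  A ℓ α * Complex.exp (Complex.I * ((α * (p * (x.1 - v * x.2.1) + q * x.2.2) : ℝ) : ℂ))

lemma isAmplitudeFamily_planeWave (ω : ℝ → ℝ) (κ p q : ℝ) {A : ℕ → ℤ → ℂ}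
    (hA : ∀ ℓ α, A ℓ (-α) = conj (A ℓ α)) :
    IsAmplitudeFamily ω κ (planeWave (deriv ω κ) p q A) where
  smooth ℓ α := by
    unfold planeWave
    refine contDiff_const.mul (contDiff_const.mul ?_).cexp
    exact Complex.ofRealCLM.contDiff.comp (contDiff_const.mul (by fun_prop))
  bounded ℓ α := ⟨‖A ℓ α‖, fun x => by
    rw [planeWave, norm_mul, mul_comm Complex.I, Complex.norm_exp_ofReal_mul_I, mul_one]⟩
  real ℓ α x := by
    rw [planeWave, planeWave, hA, map_mul, ← Complex.exp_conj, map_mul, Complex.conj_ofReal,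
      Complex.conj_I]
    push_cast
    ring_nf
  travelling ℓ α n m l := by
    simp [planeWave]

lemma D_planeWave (v p q : ℝ) (A : ℕ → ℤ → ℂ) (ℓ : ℕ) (α : ℤ) (w : Slow) :
    D w (planeWave v p q A ℓ α) = fun x =>
      (Complex.I * ((α * (p * (w.1 - v * w.2.1) + q * w.2.2) : ℝ) : ℂ))
        * planeWave v p q A ℓ α x := by
  funext x
  let φ : Slow →L[ℝ] ℝ := (α : ℝ) • (p • ((ContinuousLinearMap.fst ℝ ℝ (ℝ × ℝ))
    - v • (ContinuousLinearMap.fst ℝ ℝ ℝ).comp (ContinuousLinearMap.snd ℝ ℝ (ℝ × ℝ)))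
    + q • (ContinuousLinearMap.snd ℝ ℝ ℝ).comp (ContinuousLinearMap.snd ℝ ℝ (ℝ × ℝ)))
  have hφ : ∀ y : Slow, φ y = α * (p * (y.1 - v * y.2.1) + q * y.2.2) := fun y => by
    simp [φ]
    ring
  have e : planeWave v p q A ℓ α
      = fun y => A ℓ α * Complex.exp (Complex.I * (Complex.ofRealCLM.comp φ) y) := by
    funext y
    simp only [planeWave, ContinuousLinearMap.comp_apply, Complex.ofRealCLM_apply, hφ]
  have hd := ((((Complex.ofRealCLM.comp φ).hasFDerivAt (x := x)).const_mul Complex.I).cexp).const_mul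
    (A ℓ α)
  rw [D, e, hd.fderiv]
  simp only [smul_apply, ContinuousLinearMap.comp_apply,
    Complex.ofRealCLM_apply, hφ, smul_eq_mul]
  ring

/-- These test amplitudes show that the conditions at orders `ε` and `ε²` are satisfiable with `u`
and its derivatives prescribed at a point, which is what makes the NLSE coefficients identifiable.
-/
lemma exists_planeWave_solution (ha : |P.a₁| ≠ |P.a₂|) (hω : IsDispersionRelation P ω)
    (hκ : IsNonresonant P ω κ) (p q : ℝ) :
    ∃ u, IsAmplitudeFamily ω κ u ∧ (∀ α x, W P ω κ u 1 α x = 0) ∧ (∀ α x, W P ω κ u 2 α x = 0) ∧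
      u 1 1 0 = 1 ∧ δm₂ (u 1 1) 0 = Complex.I * q ∧ δn₁ (δn₁ (u 1 1)) 0 = -(p : ℂ) ^ 2 := by
  have hs : (P.a₁ : ℂ) + P.a₂ ≠ 0 := mod_cast add_ne_zero_of_abs_ne ha
  -- `C` and `M` solve `𝒲₂^{(2)} = 0` and `𝒲₂^{(0)} = 0` for a first harmonic of modulus one.
  set C : ℂ := -symbol₁₁ P (waveK κ) (waveΩ ω κ) / linSymbol P (waveK κ ^ 2) (waveΩ ω κ ^ 2)
    with hC
  set M : ℂ := -symbolMean P (waveK κ) (waveΩ ω κ) / (2 * (P.a₁ + P.a₂)) with hM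
  have hMc : conj M = M := by
    rw [hM, map_div₀, map_neg, conj_symbolMean, map_mul, map_ofNat, map_add, Complex.conj_ofReal, Complex.conj_ofReal]
  let A : ℕ → ℤ → ℂ := fun ℓ α =>
    if ℓ = 1 then (if α = 1 ∨ α = -1 then 1 else 0)
    else if ℓ = 2 then (if α = 2 then C else if α = -2 then conj C else if α = 0 then M else 0)
    else 0
  have hA : ∀ ℓ α, A ℓ (-α) = conj (A ℓ α) := by
    intro ℓ α
    simp only [A]
    split_ifs <;> first | omega | simp [hMc]
  have hL : linSymbol P (waveK κ)⁻¹ (waveΩ ω κ)⁻¹ = 0 := by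
    rw [← conj_waveK, ← conj_waveΩ, ← conj_linSymbol, hω.2 κ, map_zero]
  have hD : symbolDrift P (waveK κ)⁻¹ (waveΩ ω κ)⁻¹ (deriv ω κ) = 0 := by
    rw [← conj_waveK, ← conj_waveΩ, ← conj_symbolDrift, hω.symbolDrift_eq_zero κ, map_zero]
  have hu := isAmplitudeFamily_planeWave ω κ p q hA
  set u := planeWave (deriv ω κ) p q A with hu_def
  have h10 : u 1 0 = 0 := by
    funext x
    simp [hu_def, planeWave, A]
  have e11 : ∀ x, u 1 1 x * u 1 (-1) x = 1 := fun x => by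
    rw [hu.real 1 1 x, Complex.mul_conj, Complex.normSq_eq_norm_sq]
    simp only [hu_def, planeWave, norm_mul, mul_comm Complex.I, Complex.norm_exp_ofReal_mul_I]
    simp [A]
  have e20 : ∀ x, u 2 0 x = M := fun x => by
    simp [hu_def, planeWave, A]
  have e22 : ∀ x, u 2 2 x = C * u 1 1 x ^ 2 := fun x => by
    simp only [hu_def, planeWave, mul_pow, ← Complex.exp_nat_mul]
    simp only [A]
    push_cast
    norm_num
    left
    ring_nf
  have w22 : ∀ x, W P ω κ u 2 2 x = 0 := fun x => by
    rw [W_two_two, e22, hC]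
    field_simp [hκ.2]
    ring
  refine ⟨u, hu, ?_, ?_, ?_, ?_, ?_⟩
  · intro α x
    by_cases h : 1 < α.natAbs
    · exact W_one_of_one_lt x h
    rw [W_one_apply x (by omega)]
    obtain rfl | rfl | rfl : α = 0 ∨ α = 1 ∨ α = -1 := by omega
    · simp [h10]
    · simp [hω.2 κ]
    · simp [hL]
  · intro α x
    by_cases h : 2 < α.natAbs
    · exact W_two_of_two_lt x h
    obtain rfl | rfl | rfl | rfl | rfl : α = 0 ∨ α = 1 ∨ α = -1 ∨ α = 2 ∨ α = -2 := by omega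
    · rw [W_two_zero x h10, e20, e11, hM]
      field_simp
      ring
    · rw [W_two_of_natAbs_eq_one hu x h10 rfl]
      simp [hω.2 κ, hω.symbolDrift_eq_zero κ]
    · rw [W_two_of_natAbs_eq_one hu x h10 rfl]
      simp [hL, hD]
    · exact w22 x
    · have := congrArg conj (w22 x)
      rw [W_two_two, map_add, map_mul, map_mul, map_zero, conj_linSymbol, conj_symbol₁₁, map_pow,
        map_pow, map_pow, conj_waveK, conj_waveΩ, ← hu.real, ← hu.real] at this
      rw [W_two_neg_two, this]
  · simp [hu_def, planeWave, A]
  · simp only [hu_def, δm₂, D_planeWave]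
    simp [planeWave, A]
  · have h1 : δn₁ (u 1 1) = fun x => (Complex.I * p) * u 1 1 x := by
      simp only [hu_def, δn₁, D_planeWave]
      simp
    have h2 : δn₁ (δn₁ (u 1 1)) 0 = (Complex.I * p) * δn₁ (u 1 1) 0 := by
      conv_lhs => rw [h1]
      exact D_const_mul (hu.differentiable 1 1) _ _ _
    rw [h2, h1]
    simp only [hu_def, planeWave, A]
    simp
    linear_combination (p : ℂ) ^ 2 * Complex.I_sq

/-- On a plane wave `e^{i(pξ + q m₂)}` the NLSE expression at the origin is `-q - ρ₁ p² + ρ₂`.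
Comparing two reductions, `q` fixes the constant `c`, then `p = q = 0` gives `ρ₂` and `p = 1` gives
`ρ₁`. -/
lemma ReducesToNLS.unique (ha : |P.a₁| ≠ |P.a₂|) (hω : IsDispersionRelation P ω)
    (hκ : IsNonresonant P ω κ) {ρ₁ ρ₂ σ₁ σ₂ : ℂ} (hρ : ReducesToNLS P ω κ ρ₁ ρ₂)
    (hσ : ReducesToNLS P ω κ σ₁ σ₂) : ρ₁ = σ₁ ∧ ρ₂ = σ₂ := by
  obtain ⟨c, hc, hρ⟩ := hρ
  obtain ⟨d, hd, hσ⟩ := hσ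
  have key : ∀ p q : ℝ, c * (-q - ρ₁ * p ^ 2 + ρ₂) = d * (-q - σ₁ * p ^ 2 + σ₂) := by
    intro p q
    obtain ⟨u, hu, h1, h2, e1, e2, e3⟩ := exists_planeWave_solution ha hω hκ p q
    have := (hρ u hu h1 h2 0).symm.trans (hσ u hu h1 h2 0)
    rw [e1, e2, e3] at this
    simp only [norm_one, Complex.ofReal_one, one_pow, mul_one] at this
    linear_combination this - (c - d) * q * Complex.I_sq
  have k0 := key 0 0
  have k1 := key 0 1
  have k2 := key 1 0
  push_cast at k0 k1 k2
  have hcd : c = d := by linear_combination k0 - k1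
  subst hcd
  have r2 : ρ₂ = σ₂ := mul_left_cancel₀ hc (by linear_combination k0)
  refine ⟨mul_left_cancel₀ hc (by linear_combination k0 - k2), r2⟩

end Reduction

/-! ### Solving the six polynomial conditions on the coefficients -/

section AlgebraicSystem

/-! ### The algebraic system -/

/-- The coefficients, as a polynomial in `tan² (κ/2)`, of the imaginary part of the nonlinear
coefficient for `a₁ = l (r + 1)`, `a₂ = l (r - 1)`, up to a common nonzero factor. -/
def imCoeff (P : Coeffs) (l r : ℝ) : ℕ → ℝ
  | 0 =>
      (-6 * r ^ 5) * P.α₂ * P.α₁ + (6 * r ^ 5) * P.α₂ * P.β₁ + (3 * r ^ 5) * P.α₂ * P.γ₁ + (3 * r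
      ^ 5) * P.α₂ * P.γ₂ + (6 * r ^ 6) * (l * (P.ξ₁ - P.ξ₂))
  | 1 =>
      (12 * r ^ 5 - 12 * r ^ 3) * P.α₂ * P.α₁ + (-8 * r ^ 5) * P.α₂ * P.β₁ + (-6 * r ^ 5 + 14 * r
      ^ 4) * P.α₂ * P.γ₁ + (-6 * r ^ 5 - 14 * r ^ 4) * P.α₂ * P.γ₂ + (6 * r ^ 4) * P.β₂ * P.α₁ +
      (-14 * r ^ 4) * P.β₂ * P.β₁ + (6 * r ^ 5 - 7 * r ^ 4) * P.β₂ * P.γ₁ + (-6 * r ^ 5 - 7 * r ^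
      4) * P.β₂ * P.γ₂ + (-8 * r ^ 6 + 16 * r ^ 4) * (l * (P.ξ₁ - P.ξ₂)) + (10 * r ^ 5) * (l *
      (P.ξ₃ - P.ξ₄))
  | 2 =>
      (2 * r ^ 5 + 8 * r ^ 3 - 6 * r) * P.α₂ * P.α₁ + (2 * r ^ 5 - 24 * r ^ 3 - 6 * r) * P.α₂ *
      P.β₁ + (-r ^ 5 - 4 * r ^ 4 + 8 * r ^ 3 + 6 * r ^ 2 - 3 * r) * P.α₂ * P.γ₁ + (-r ^ 5 + 4 * r
      ^ 4 + 8 * r ^ 3 - 6 * r ^ 2 - 3 * r) * P.α₂ * P.γ₂ + (8 * r ^ 4 - 16 * r ^ 2) * P.β₂ * P.α₁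
      + (-12 * r ^ 4 - 4 * r ^ 2) * P.β₂ * P.β₁ + (-2 * r ^ 5 + 8 * r ^ 4 - 4 * r ^ 3 - 2 * r ^ 2)
      * P.β₂ * P.γ₁ + (2 * r ^ 5 + 8 * r ^ 4 + 4 * r ^ 3 - 2 * r ^ 2) * P.β₂ * P.γ₂ + (2 * r ^ 6 -
      8 * r ^ 4 - 6 * r ^ 2) * (l * (P.ξ₁ - P.ξ₂)) + (-8 * r ^ 5 + 32 * r ^ 3) * (l * (P.ξ₃ -
      P.ξ₄))
  | 3 =>
      (-12 * r ^ 3 - 4 * r) * P.α₂ * P.α₁ + (8 * r ^ 3 - 16 * r) * P.α₂ * P.β₁ + (-2 * r ^ 4 + 8 *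
      r ^ 3 - 4 * r ^ 2 - 2 * r) * P.α₂ * P.γ₁ + (2 * r ^ 4 + 8 * r ^ 3 + 4 * r ^ 2 - 2 * r) *
      P.α₂ * P.γ₂ + (2 * r ^ 4 - 24 * r ^ 2 - 6) * P.β₂ * P.α₁ + (2 * r ^ 4 + 8 * r ^ 2 - 6) *
      P.β₂ * P.β₁ + (-r ^ 4 - 4 * r ^ 3 + 8 * r ^ 2 + 6 * r - 3) * P.β₂ * P.γ₁ + (-r ^ 4 + 4 * r ^
      3 + 8 * r ^ 2 - 6 * r - 3) * P.β₂ * P.γ₂ + (8 * r ^ 4 - 32 * r ^ 2) * (l * (P.ξ₁ - P.ξ₂)) +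
      (-2 * r ^ 5 + 8 * r ^ 3 + 6 * r) * (l * (P.ξ₃ - P.ξ₄))
  | 4 =>
      (-14 * r) * P.α₂ * P.α₁ + (6 * r) * P.α₂ * P.β₁ + (6 * r ^ 2 - 7 * r) * P.α₂ * P.γ₁ + (-6 *
      r ^ 2 - 7 * r) * P.α₂ * P.γ₂ + (-8 * r ^ 2) * P.β₂ * P.α₁ + (12 * r ^ 2 - 12) * P.β₂ * P.β₁
      + (-6 * r ^ 2 + 14 * r) * P.β₂ * P.γ₁ + (-6 * r ^ 2 - 14 * r) * P.β₂ * P.γ₂ + (-10 * r ^ 2)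
      * (l * (P.ξ₁ - P.ξ₂)) + (8 * r ^ 3 - 16 * r) * (l * (P.ξ₃ - P.ξ₄))
  | 5 =>
      6 * P.β₂ * P.α₁ + (-6) * P.β₂ * P.β₁ + 3 * P.β₂ * P.γ₁ + 3 * P.β₂ * P.γ₂ + (-6 * r) * (l *
      (P.ξ₃ - P.ξ₄))
  | _ => 0

section Families

variable {P : Coeffs} {l r : ℝ}

lemma eq_of_mul_sub_eq {x y : ℝ} (hl : l ≠ 0) (hr : r ≠ 0) (h : r * (l * (x - y)) = 0) :
    x = y :=
  sub_eq_zero.mp ((mul_eq_zero.mp ((mul_eq_zero.mp h).resolve_left hr)).resolve_left hl)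

lemma S5_of_eq (hr : r ≠ 0) (h₁ : P.a₁ = l * (r + 1)) (h₂ : P.a₂ = l * (r - 1))
    (hx : r * (l * (P.ξ₁ - P.ξ₂)) = P.α₂ * (P.α₁ - P.β₁ - (P.γ₁ + P.γ₂) / 2))
    (hy : r * (l * (P.ξ₃ - P.ξ₄)) = P.β₂ * (P.α₁ - P.β₁ + (P.γ₁ + P.γ₂) / 2))
    (hb : P.β₂ = -r * P.α₂)
    (hU : P.γ₁ + P.γ₂ - r * (P.γ₁ - P.γ₂) = 2 * (P.α₁ - P.β₁))
    (hV : (r ^ 2 - 1) * (P.α₁ + P.β₁ - r * (P.γ₁ - P.γ₂)) = (3 * r ^ 2 + 1) * (P.α₁ - P.β₁)) :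
    S5 P := by
  have hx' : l * (P.ξ₁ - P.ξ₂) = -P.α₂ * (P.γ₁ - P.γ₂) / 2 :=
    mul_left_cancel₀ hr (by linear_combination hx - P.α₂ / 2 * hU)
  have hy' : l * (P.ξ₃ - P.ξ₄) = -P.α₂ * (P.α₁ - P.β₁ + (P.γ₁ + P.γ₂) / 2) :=
    mul_left_cancel₀ hr (by rw [hy, hb]; ring)
  rw [S5, h₁, h₂, hb]
  refine ⟨by ring, ?_, ?_, ?_, ?_⟩
  · linear_combination 2 * l ^ 3 * hV - 4 * l ^ 3 * r ^ 2 * hU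
  · linear_combination l ^ 2 * hV - l ^ 2 * (r ^ 2 + 1) * hU
  · linear_combination -2 * hx'
  · linear_combination 4 * l * hy' - 2 * l * P.α₂ * (-hU)

/-- Mirror image of `S5_of_eq` under `n ↔ m`, which swaps `αᵢ` with `βᵢ` and sends `ξ₁ - ξ₂` to
`-(ξ₃ - ξ₄)` and conversely. -/
lemma S6_of_eq (hr : r ≠ 0) (h₁ : P.a₁ = l * (r + 1)) (h₂ : P.a₂ = l * (r - 1))
    (hx : r * (l * (P.ξ₁ - P.ξ₂)) = P.α₂ * (P.α₁ - P.β₁ - (P.γ₁ + P.γ₂) / 2))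
    (hy : r * (l * (P.ξ₃ - P.ξ₄)) = P.β₂ * (P.α₁ - P.β₁ + (P.γ₁ + P.γ₂) / 2))
    (hb : P.α₂ = -r * P.β₂)
    (hU : P.γ₁ + P.γ₂ - r * (P.γ₁ - P.γ₂) = -2 * (P.α₁ - P.β₁))
    (hV : (r ^ 2 - 1) * (P.α₁ + P.β₁ - r * (P.γ₁ - P.γ₂)) = -(3 * r ^ 2 + 1) * (P.α₁ - P.β₁)) :
    S6 P := by
  have hx' : l * (P.ξ₁ - P.ξ₂) = -P.β₂ * (P.α₁ - P.β₁ - (P.γ₁ + P.γ₂) / 2) :=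
    mul_left_cancel₀ hr (by rw [hx, hb]; ring)
  have hy' : l * (P.ξ₃ - P.ξ₄) = P.β₂ * (P.γ₁ - P.γ₂) / 2 :=
    mul_left_cancel₀ hr (by linear_combination hy + P.β₂ / 2 * hU)
  rw [S6, h₁, h₂, hb]
  refine ⟨by ring, ?_, ?_, ?_, ?_⟩
  · linear_combination l ^ 2 * hV - l ^ 2 * (r ^ 2 + 1) * hU
  · linear_combination 2 * l ^ 3 * hV - 4 * l ^ 3 * r ^ 2 * hU
  · linear_combination -4 * l * r * hx' + 2 * l * r * P.β₂ * hU
  · linear_combination 2 * r * hy'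

/-- If the imaginary part of the nonlinear coefficient vanishes identically, the equation
belongs to one of the six families. -/
theorem mem_families_of_imCoeff_eq_zero (hl : l ≠ 0) (hr : r ≠ 0) (hr₁ : r ^ 2 ≠ 1)
    (h₁ : P.a₁ = l * (r + 1)) (h₂ : P.a₂ = l * (r - 1))
    (h : ∀ i < 6, imCoeff P l r i = 0) :
    S1 P ∨ S2 P ∨ S3 P ∨ S4 P ∨ S5 P ∨ S6 P := by
  have c0 := h 0 (by norm_num)
  have c1 := h 1 (by norm_num)
  have c2 := h 2 (by norm_num)
  have c3 := h 3 (by norm_num)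
  have c4 := h 4 (by norm_num)
  have c5 := h 5 (by norm_num)
  simp only [imCoeff] at c0 c1 c2 c3 c4 c5
  have hx : r * (l * (P.ξ₁ - P.ξ₂)) = P.α₂ * (P.α₁ - P.β₁ - (P.γ₁ + P.γ₂) / 2) :=
    mul_left_cancel₀ (pow_ne_zero 5 hr) (by linear_combination c0 / 6)
  have hy : r * (l * (P.ξ₃ - P.ξ₄)) = P.β₂ * (P.α₁ - P.β₁ + (P.γ₁ + P.γ₂) / 2) := by
    linear_combination -c5 / 6
  set a := P.α₂ with ha
  set b := P.β₂ with hb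
  -- After elimination of the `ξ` differences, only these three combinations survive. The reflection
  -- `n ↔ m` fixes `U` and `V`, negates `d` and swaps `a` with `b`; it exchanges `E₁` with `E₂` and
  -- `E₃` with `E₄`.
  obtain ⟨d, hd⟩ : ∃ d, d = P.α₁ - P.β₁ := ⟨_, rfl⟩
  obtain ⟨U, hU⟩ : ∃ U, U = P.γ₁ + P.γ₂ - r * (P.γ₁ - P.γ₂) := ⟨_, rfl⟩
  obtain ⟨V, hV⟩ : ∃ V, V = P.α₁ + P.β₁ - r * (P.γ₁ - P.γ₂) := ⟨_, rfl⟩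
  have E₁ : V * ((r ^ 2 - 3) * a - 2 * r * b) + d * ((r ^ 2 + 5) * a + 10 * r * b)
      - U * ((r ^ 2 + 4) * a + r * b) = 0 := by
    rw [hd, hU, hV]
    refine mul_left_cancel₀ (pow_ne_zero 4 hr) ?_
    linear_combination r / 2 * c1 - (-8 * r ^ 6 + 16 * r ^ 4) / 2 * hx - 10 * r ^ 5 / 2 * hy
  have E₂ : V * ((r ^ 2 - 3) * b - 2 * r * a) - d * ((r ^ 2 + 5) * b + 10 * r * a)
      - U * ((r ^ 2 + 4) * b + r * a) = 0 := by
    rw [hd, hU, hV]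
    refine mul_left_cancel₀ hr ?_
    linear_combination r / 2 * c4 + 10 * r ^ 2 / 2 * hx - (8 * r ^ 3 - 16 * r) / 2 * hy
  have E₃ : 2 * (r ^ 2 - 1) * (a - r * b) * d
      + U * ((3 * r ^ 2 + 1) * a + (r ^ 3 + 3 * r) * b) = 0 := by
    refine mul_left_cancel₀ (pow_ne_zero 2 hr) ?_
    -- Subtracting multiples of `E₁` and `E₂` from the middle coefficients removes `V`.
    have : 4 * r ^ 2 * (2 * (r ^ 2 - 1) * (a - r * b) * d
      + U * ((3 * r ^ 2 + 1) * a + (r ^ 3 + 3 * r) * b))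
      + (r ^ 4 + r ^ 2) * (V * ((r ^ 2 - 3) * a - 2 * r * b) + d * ((r ^ 2 + 5) * a + 10 * r * b)
      - U * ((r ^ 2 + 4) * a + r * b)) + r ^ 3 * (V * ((r ^ 2 - 3) * b - 2 * r * a)
      - d * ((r ^ 2 + 5) * b + 10 * r * a) - U * ((r ^ 2 + 4) * b + r * a)) = 0 := by
      rw [hd, hU, hV]
      linear_combination r / 2 * c2 - (2 * r ^ 6 - 8 * r ^ 4 - 6 * r ^ 2) / 2 * hx
        - (-8 * r ^ 5 + 32 * r ^ 3) / 2 * hy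
    linear_combination this / 4 - (r ^ 4 + r ^ 2) / 4 * E₁ - r ^ 3 / 4 * E₂
  have E₄ : -2 * (r ^ 2 - 1) * (b - r * a) * d
      + U * ((3 * r ^ 2 + 1) * b + (r ^ 3 + 3 * r) * a) = 0 := by
    refine mul_left_cancel₀ hr ?_
    have : 4 * r * (-2 * (r ^ 2 - 1) * (b - r * a) * d
      + U * ((3 * r ^ 2 + 1) * b + (r ^ 3 + 3 * r) * a))
      + (r ^ 3 + r) * (V * ((r ^ 2 - 3) * b - 2 * r * a) - d * ((r ^ 2 + 5) * b + 10 * r * a)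
      - U * ((r ^ 2 + 4) * b + r * a)) + r ^ 2 * (V * ((r ^ 2 - 3) * a - 2 * r * b)
      + d * ((r ^ 2 + 5) * a + 10 * r * b) - U * ((r ^ 2 + 4) * a + r * b)) = 0 := by
      rw [hd, hU, hV]
      linear_combination r / 2 * c3 - (8 * r ^ 4 - 32 * r ^ 2) / 2 * hx
        - (-2 * r ^ 5 + 8 * r ^ 3 + 6 * r) / 2 * hy
    linear_combination this / 4 - (r ^ 3 + r) / 4 * E₂ - r ^ 2 / 4 * E₁
  clear c0 c1 c2 c3 c4 c5 h
  have hm : r ^ 2 - 1 ≠ 0 := sub_ne_zero.mpr hr₁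
  have hp : r ^ 2 + 1 ≠ 0 := by positivity
  by_cases hab : a = 0 ∧ b = 0
  · rw [hab.1, zero_mul] at hx
    rw [hab.2, zero_mul] at hy
    exact Or.inl ⟨hab.1, hab.2, eq_of_mul_sub_eq hl hr hx, eq_of_mul_sub_eq hl hr hy⟩
  by_cases h5 : b = -r * a
  · have ha0 : a ≠ 0 := fun h => hab ⟨h, by rw [h5, h, mul_zero]⟩
    rw [h5] at E₁ E₃
    have hU' : U = 2 * d :=
      mul_left_cancel₀ (mul_ne_zero (mul_ne_zero hm hp) ha0) (by linear_combination -E₃)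
    have hV' : (r ^ 2 - 1) * V = (3 * r ^ 2 + 1) * d :=
      mul_left_cancel₀ (mul_ne_zero three_ne_zero ha0)
        (by rw [hU'] at E₁; linear_combination E₁)
    rw [hU, hd] at hU'
    rw [hV, hd] at hV'
    exact Or.inr (Or.inr (Or.inr (Or.inr (Or.inl (S5_of_eq hr h₁ h₂ hx hy h5 hU' hV')))))
  by_cases h6 : a = -r * b
  · have hb0 : b ≠ 0 := fun h => hab ⟨by rw [h6, h, mul_zero], h⟩
    rw [h6] at E₂ E₄
    have hU' : U = -2 * d :=
      mul_left_cancel₀ (mul_ne_zero (mul_ne_zero hm hp) hb0) (by linear_combination -E₄)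
    have hV' : (r ^ 2 - 1) * V = -(3 * r ^ 2 + 1) * d :=
      mul_left_cancel₀ (mul_ne_zero three_ne_zero hb0)
        (by rw [hU'] at E₂; linear_combination E₂)
    rw [hU, hd] at hU'
    rw [hV, hd] at hV'
    exact Or.inr (Or.inr (Or.inr (Or.inr (Or.inr (S6_of_eq hr h₁ h₂ hx hy h6 hU' hV')))))
  -- Up to sign, the determinant of `E₃`, `E₄` as a system in `d`, `U`; its zeros are the cases
  -- leading to (S5) and (S6).
  have hdet : 4 * (r ^ 2 - 1) ^ 2 * ((a + r * b) * (b + r * a)) ≠ 0 := by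
    refine mul_ne_zero (mul_ne_zero four_ne_zero (pow_ne_zero 2 hm)) (mul_ne_zero ?_ ?_)
    · exact fun h => h6 (by linear_combination h)
    · exact fun h => h5 (by linear_combination h)
  have hU0 : U = 0 := by
    refine mul_left_cancel₀ hdet ?_
    linear_combination (-2 * (r ^ 2 - 1) * (a - r * b)) * E₄
      + (-2 * (r ^ 2 - 1) * (b - r * a)) * E₃
  have hd0 : d = 0 := by
    refine mul_left_cancel₀ hdet ?_
    linear_combination (-((3 * r ^ 2 + 1) * b + (r ^ 3 + 3 * r) * a)) * E₃
      + ((3 * r ^ 2 + 1) * a + (r ^ 3 + 3 * r) * b) * E₄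
  rw [hU0, hd0] at E₁ E₂
  have hU1 : P.γ₁ + P.γ₂ = r * (P.γ₁ - P.γ₂) := by linear_combination hU0 - hU
  have hd1 : P.α₁ = P.β₁ := by linear_combination hd0 - hd
  have hx' : l * (P.ξ₁ - P.ξ₂) = -a * (P.γ₁ - P.γ₂) / 2 :=
    mul_left_cancel₀ hr (by linear_combination hx - a / 2 * hU1 + a * hd1)
  have hy' : l * (P.ξ₃ - P.ξ₄) = b * (P.γ₁ - P.γ₂) / 2 :=
    mul_left_cancel₀ hr (by linear_combination hy + b / 2 * hU1 + b * hd1)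
  by_cases hV0 : V = 0
  · have hV1 : P.α₁ + P.β₁ = r * (P.γ₁ - P.γ₂) := by linear_combination hV0 - hV
    refine Or.inr (Or.inr (Or.inr (Or.inl ?_)))
    rw [S4, h₁, h₂, ← ha, ← hb]
    refine ⟨?_, ?_, ?_, ?_, ?_⟩
    · linear_combination l * (r - 1) / 2 * (hV1 + hd1) - l * r / 2 * hU1
    · linear_combination l * (r - 1) / 2 * (hV1 - hd1) - l * r / 2 * hU1
    · linear_combination -l * hU1
    · linear_combination (r + 1) * hx' + a / 2 * hU1
    · linear_combination (r + 1) * hy' - b / 2 * hU1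
  have E₁' : (r ^ 2 - 3) * a - 2 * r * b = 0 :=
    mul_left_cancel₀ hV0 (by linear_combination E₁)
  have E₂' : (r ^ 2 - 3) * b - 2 * r * a = 0 :=
    mul_left_cancel₀ hV0 (by linear_combination E₂)
  -- For `V ≠ 0`, a nonzero `(a, b)` solves a system of determinant `(r² - 3)² - 4r² = (r² - 1)(r² -
  -- 9)`. The roots `r = 3` and `r = -3` give (S2) and (S3).
  have hr9 : (r - 3) * (r + 3) = 0 := by
    have hka : (r ^ 2 - 1) * ((r - 3) * (r + 3)) * a = 0 := by
      linear_combination (r ^ 2 - 3) * E₁' + 2 * r * E₂'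
    have hkb : (r ^ 2 - 1) * ((r - 3) * (r + 3)) * b = 0 := by
      linear_combination (r ^ 2 - 3) * E₂' + 2 * r * E₁'
    by_contra hne
    have hk := mul_ne_zero hm hne
    exact hab ⟨(mul_eq_zero.mp hka).resolve_left hk, (mul_eq_zero.mp hkb).resolve_left hk⟩
  rcases mul_eq_zero.mp hr9 with h3 | h3
  · obtain rfl : r = 3 := by linear_combination h3
    have hab' : a = b := by linear_combination E₁' / 6
    refine Or.inr (Or.inl ⟨hab', hd1, ?_, ?_, ?_, ?_⟩)
    · rw [h₁, h₂]; ring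
    · linear_combination -hU1 / 2
    · rw [h₁, ← ha]; linear_combination 4 * hx' + a * hU1
    · rw [h₁, ← ha]; linear_combination -4 * hy' + a * hU1 + 2 * (P.γ₁ - P.γ₂) * hab'
  · obtain rfl : r = -3 := by linear_combination h3
    have hab' : a = -b := by linear_combination E₁' / 6
    refine Or.inr (Or.inr (Or.inl ⟨hab', hd1, ?_, ?_, ?_, ?_⟩))
    · rw [h₁, h₂]; ring
    · linear_combination -hU1 / 2
    · rw [h₁, ← ha]; linear_combination -2 * hx' + a / 2 * hU1
    · rw [h₁, ← ha]; linear_combination -2 * hy' + a / 2 * hU1 - (P.γ₁ - P.γ₂) * hab'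

end Families

end AlgebraicSystem

/-! ### Existence and rational parametrisation of the dispersion relation -/

section Dispersion

variable {P : Coeffs} {ω : ℝ → ℝ} {κ : ℝ}

/-! ### Dispersion relations exist -/

lemma exp_two_arctan_mul (x : ℝ) :
    Complex.exp (Complex.I * ((2 * Real.arctan x : ℝ) : ℂ)) * (1 - Complex.I * x)
      = 1 + Complex.I * x := by
  have hs : (0 : ℝ) < 1 + x ^ 2 := by positivity
  have h1 : Complex.exp (Complex.I * (Real.arctan x : ℂ)) * (Real.sqrt (1 + x ^ 2) : ℂ)
      = 1 + Complex.I * x := by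
    have hne : (Real.sqrt (1 + x ^ 2) : ℂ) ≠ 0 := mod_cast (Real.sqrt_pos.mpr hs).ne'
    rw [mul_comm Complex.I, Complex.exp_mul_I, ← Complex.ofReal_cos, ← Complex.ofReal_sin,
      Real.cos_arctan, Real.sin_arctan]
    push_cast
    field_simp
  have h2 : (1 + Complex.I * x) * (1 - Complex.I * x) = (Real.sqrt (1 + x ^ 2) : ℂ) ^ 2 := by
    rw [← Complex.ofReal_pow, Real.sq_sqrt hs.le]
    push_cast
    linear_combination (-(x : ℂ) ^ 2) * Complex.I_sq
  have hne : (1 + Complex.I * x : ℂ) ≠ 0 := by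
    intro h
    simpa using congrArg Complex.re h
  have h3 : Complex.exp (Complex.I * ((2 * Real.arctan x : ℝ) : ℂ))
      = Complex.exp (Complex.I * (Real.arctan x : ℂ)) ^ 2 := by
    rw [← Complex.exp_nat_mul]
    push_cast
    ring_nf
  refine mul_left_cancel₀ hne ?_
  rw [h3]
  calc _ = Complex.exp (Complex.I * (Real.arctan x : ℂ)) ^ 2
        * ((1 + Complex.I * x) * (1 - Complex.I * x)) := by ring
    _ = _ := by rw [h2, ← mul_pow, h1]; ring

/-- The solution is `Ω = -K⁻¹ (a + bK) / (a + bK⁻¹)`, a quotient of conjugates. As `a + b cos k`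
never vanishes, its phase is globally `2 arctan (b sin k / (a + b cos k))`, so `ω` is differentiable
on the whole line. -/
lemma exists_dispersion_of_abs_lt {a b : ℝ} (h : |b| < |a|) :
    ∃ ω : ℝ → ℝ, Differentiable ℝ ω ∧
      ∀ k, (a : ℂ) * (1 + waveK k * waveΩ ω k) + b * (waveK k + waveΩ ω k) = 0 := by
  have hne : ∀ k, a + b * Real.cos k ≠ 0 := by
    intro k hk
    have h1 : |a| = |b| * |Real.cos k| := by
      rw [← abs_mul, ← abs_neg (b * _)]
      congr 1
      linear_combination hk
    have h2 := mul_le_mul_of_nonneg_left (Real.abs_cos_le_one k) (abs_nonneg b)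
    linarith
  refine ⟨fun k => k - Real.pi - 2 * Real.arctan (b * Real.sin k / (a + b * Real.cos k)), ?_, ?_⟩
  · have hq : Differentiable ℝ fun k => b * Real.sin k / (a + b * Real.cos k) := fun k =>
      ((Real.differentiable_sin k).const_mul b).div
        (((Real.differentiable_cos k).const_mul b).const_add a) (hne k)
    exact (differentiable_id.sub_const _).sub (hq.arctan.const_mul 2)
  · intro k
    set x := b * Real.sin k / (a + b * Real.cos k) with hx
    set E := Complex.exp (Complex.I * ((2 * Real.arctan x : ℝ) : ℂ)) with hE
    have hK := waveK_ne_zero k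
    have hΩ : waveΩ (fun k => k - Real.pi
        - 2 * Real.arctan (b * Real.sin k / (a + b * Real.cos k))) k = -(waveK k)⁻¹ * E := by
      have hneg : ∀ y : ℂ, -y * E = Complex.exp (Real.pi * Complex.I) * y * E := fun y => by
        rw [Complex.exp_pi_mul_I]
        ring
      rw [hneg, waveΩ, ← hx, waveK, ← Complex.exp_neg, hE, ← Complex.exp_add, ← Complex.exp_add]
      push_cast
      ring_nf
    have hKcs : waveK k = Real.cos k + Complex.I * Real.sin k := by
      rw [waveK, mul_comm, Complex.exp_mul_I, ← Complex.ofReal_cos, ← Complex.ofReal_sin]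
      ring
    have hKcs' : (waveK k)⁻¹ = Real.cos k - Complex.I * Real.sin k := by
      rw [← conj_waveK, hKcs]
      simp only [map_add, map_mul, Complex.conj_I, Complex.conj_ofReal]
      ring
    have hA : ((a + b * Real.cos k : ℝ) : ℂ) ≠ 0 := mod_cast hne k
    have hE' : E * (a + b * (waveK k)⁻¹) = a + b * waveK k := by
      have h0 := exp_two_arctan_mul x
      have hx' : ((a + b * Real.cos k : ℝ) : ℂ) * (x : ℂ) = b * Real.sin k := by
        rw [hx, ← Complex.ofReal_mul, mul_div_cancel₀ _ (hne k)]
        push_cast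
        rfl
      rw [hKcs', hKcs]
      rw [← hE] at h0
      push_cast at hx' ⊢
      linear_combination (a + b * Complex.cos k) * h0 + Complex.I * (1 + E) * hx'
    rw [hΩ]
    field_simp at hE' ⊢
    linear_combination -hE'

/-- Without a dispersion relation the `A₁` test would be vacuous. Replacing `Ω` by `Ω⁻¹` exchanges
`a₁` and `a₂`, which settles the case `|a₁| < |a₂|`. -/
lemma exists_isDispersionRelation (ha : |P.a₁| ≠ |P.a₂|) :
    ∃ ω, IsDispersionRelation P ω := by
  rcases lt_or_gt_of_ne ha with h | h
  · obtain ⟨ω, hω, hz⟩ := exists_dispersion_of_abs_lt h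
    refine ⟨fun k => -ω k, hω.neg, fun k => ?_⟩
    have hΩ : waveΩ (fun k => -ω k) k = (waveΩ ω k)⁻¹ := by
      rw [waveΩ, waveΩ, ← Complex.exp_neg]
      push_cast
      ring_nf
    have h0 := waveΩ_ne_zero ω k
    rw [linSymbol, hΩ]
    field_simp
    linear_combination hz k
  · obtain ⟨ω, hω, hz⟩ := exists_dispersion_of_abs_lt h
    exact ⟨ω, hω, hz⟩

/-! ### Rational parametrisation by `t = tan (κ/2)` -/

variable {l r t : ℝ}

lemma mk_ne_zero_of_re {x y : ℝ} (h : x ≠ 0) : (⟨x, y⟩ : ℂ) ≠ 0 := fun e =>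
  h (congrArg Complex.re e)

lemma waveK_two_arctan (t : ℝ) : waveK (2 * Real.arctan t) = ⟨1, t⟩ / ⟨1, -t⟩ := by
  have h := exp_two_arctan_mul t
  have e1 : (⟨1, t⟩ : ℂ) = 1 + Complex.I * t := by apply Complex.ext <;> simp
  have e2 : (⟨1, -t⟩ : ℂ) = 1 - Complex.I * t := by apply Complex.ext <;> simp
  rw [eq_div_iff (mk_ne_zero_of_re one_ne_zero), waveK, e1, e2, h]

lemma waveΩ_two_arctan (hl : l ≠ 0) (ht : t ≠ 0) (h₁ : P.a₁ = l * (r + 1))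
    (h₂ : P.a₂ = l * (r - 1)) (hω : IsDispersionRelation P ω) :
    waveΩ ω (2 * Real.arctan t) = ⟨t, r⟩ / ⟨t, -r⟩ := by
  have h := hω.2 (2 * Real.arctan t)
  have hw : (⟨1, -t⟩ : ℂ) ≠ 0 := mk_ne_zero_of_re one_ne_zero
  have hl' : (l : ℂ) ≠ 0 := mod_cast hl
  rw [linSymbol, waveK_two_arctan, h₁, h₂] at h
  rw [eq_div_iff (mk_ne_zero_of_re ht)]
  generalize waveΩ ω (2 * Real.arctan t) = Ω at *
  have e1 : (⟨1, t⟩ : ℂ) = 1 + Complex.I * t := by apply Complex.ext <;> simp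
  have e2 : (⟨1, -t⟩ : ℂ) = 1 - Complex.I * t := by apply Complex.ext <;> simp
  have e3 : (⟨t, r⟩ : ℂ) = t + Complex.I * r := by apply Complex.ext <;> simp
  have e4 : (⟨t, -r⟩ : ℂ) = t - Complex.I * r := by apply Complex.ext <;> simp
  field_simp at h
  rw [e1, e2] at h
  rw [e3, e4]
  push_cast at h
  refine mul_left_cancel₀ (mul_ne_zero two_ne_zero hl') ?_
  linear_combination (-Complex.I) * h + (2 * l * Ω * t - 2 * l * t) * Complex.I_sq

end Dispersion

/-! ### The imaginary part of the nonlinear coefficient as a polynomial in `t` -/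

section RealityCondition

section ImaginaryPart

lemma mul_conj_mk (x y : ℝ) : (⟨x, y⟩ : ℂ) * ⟨x, -y⟩ = ((x ^ 2 + y ^ 2 : ℝ) : ℂ) := by
  apply Complex.ext <;> simp only [Complex.mul_re, Complex.mul_im, Complex.ofReal_re,
    Complex.ofReal_im] <;> ring

variable (P : Coeffs) (l r t : ℝ)

/-- `|1 + i t|² |t + i r|²` -/
def normFactor : ℝ := (1 + t ^ 2) * (t ^ 2 + r ^ 2)

/-- The value of `linSymbol` on the second harmonic, up to the factor `K Ω / normFactor`. -/
def linTwo : ℝ := 4 * l * r * ((1 - t ^ 2) * (t ^ 2 - r ^ 2) - 4 * t ^ 2)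

/-- `symbolMean` times `normFactor`. -/
def meanReal : ℝ :=
  4 * P.α₁ * (1 - t ^ 2) * (t ^ 2 + r ^ 2) + 4 * P.β₁ * (t ^ 2 - r ^ 2) * (1 + t ^ 2)
    + 2 * P.γ₁ * ((1 - t ^ 2) * (t ^ 2 - r ^ 2) - 4 * t ^ 2 * r)
    + 2 * P.γ₂ * ((1 - t ^ 2) * (t ^ 2 - r ^ 2) + 4 * t ^ 2 * r)

/-- The real part of `symbol₁₁ / (K Ω)` times `normFactor`. -/
def symbol₁₁Re : ℝ :=
  2 * P.α₁ * (t ^ 2 - r ^ 2) * (1 + t ^ 2) + 2 * P.β₁ * (1 - t ^ 2) * (t ^ 2 + r ^ 2)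
    + (P.γ₁ + P.γ₂) * ((1 + t ^ 2) * (t ^ 2 + r ^ 2))

/-- The imaginary part of `symbol₁₁ / (K Ω)` times `normFactor`. -/
def symbol₁₁Im : ℝ :=
  4 * P.α₂ * (t * r) * (1 + t ^ 2) + 4 * P.β₂ * t * (t ^ 2 + r ^ 2)

/-- The real part of `symbol₀₁ / ((1 + i t) (t + i r))` times `normFactor`. -/
def symbol₀₁Re : ℝ :=
  4 * P.α₁ * t + 4 * P.β₁ * t + 2 * P.γ₁ * (t - t * r) + 2 * P.γ₂ * (t + t * r)

/-- The imaginary part of `symbol₀₁ / ((1 + i t) (t + i r))` times `normFactor`. -/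
def symbol₀₁Im : ℝ := 4 * P.α₂ * r + 4 * P.β₂ * t ^ 2

/-- The real part of `symbol₂₁ / ((1 + i t) (t + i r))` times `normFactor²`. -/
def symbol₂₁Re : ℝ :=
  4 * P.α₁ * ((1 - 3 * t ^ 2) * t) * (t ^ 2 + r ^ 2)
    + 4 * P.β₁ * (t ^ 3 - 3 * t * r ^ 2) * (1 + t ^ 2)
    + 2 * P.γ₁ * ((1 - 3 * t ^ 2) * (t ^ 3 - 3 * t * r ^ 2)
        - (3 * t - t ^ 3) * (3 * t ^ 2 * r - r ^ 3))
    + 2 * P.γ₂ * ((1 - 3 * t ^ 2) * (t ^ 3 - 3 * t * r ^ 2)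
        + (3 * t - t ^ 3) * (3 * t ^ 2 * r - r ^ 3))

/-- The imaginary part of `symbol₂₁ / ((1 + i t) (t + i r))` times `normFactor²`. -/
def symbol₂₁Im : ℝ :=
  4 * P.α₂ * ((1 - 3 * t ^ 2) * r) * (t ^ 2 + r ^ 2)
    + 4 * P.β₂ * ((t ^ 3 - 3 * t * r ^ 2) * t) * (1 + t ^ 2)

/-- The imaginary part of `symbolCubic / ((1 + i t) (t + i r))` times `normFactor²`. -/
def symbolCubicIm : ℝ :=
  (P.ξ₁ - P.ξ₂ - (P.ξ₃ - P.ξ₄)) *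
      ((t ^ 2 + r) * ((1 + t ^ 2) * (t ^ 2 + r ^ 2))
        + ((1 - 3 * t ^ 2) * r - (3 * t - t ^ 3) * t) * (t ^ 2 + r ^ 2)
        + (t * (t ^ 3 - 3 * t * r ^ 2) - (3 * t ^ 2 * r - r ^ 3)) * (1 + t ^ 2))
    + (P.ξ₁ - P.ξ₂ + (P.ξ₃ - P.ξ₄)) *
      (((1 - 3 * t ^ 2) * r + (3 * t - t ^ 3) * t) * (t ^ 2 + r ^ 2)
        + (r - t ^ 2) * ((1 + t ^ 2) * (t ^ 2 + r ^ 2))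
        - (t * (t ^ 3 - 3 * t * r ^ 2) + (3 * t ^ 2 * r - r ^ 3)) * (1 + t ^ 2))

variable {P l r t}

lemma ofReal_normFactor :
    (normFactor r t : ℂ) = (⟨1, t⟩ * ⟨1, -t⟩) * (⟨t, r⟩ * ⟨t, -r⟩) := by
  rw [mul_conj_mk, mul_conj_mk, normFactor]
  push_cast
  ring

lemma ofReal_linTwo :
    (linTwo l r t : ℂ) = (l * (r + 1) : ℝ) * (⟨1, t⟩ ^ 2 * ⟨t, r⟩ ^ 2
      + ⟨1, -t⟩ ^ 2 * ⟨t, -r⟩ ^ 2) + (l * (r - 1) : ℝ) * (⟨1, t⟩ ^ 2 * ⟨t, -r⟩ ^ 2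
      + ⟨1, -t⟩ ^ 2 * ⟨t, r⟩ ^ 2) := by
  apply Complex.ext <;> simp [linTwo, pow_succ] <;> ring

lemma ofReal_meanReal :
    (meanReal P r t : ℂ) = 2 * P.α₁ * (⟨1, t⟩ ^ 2 + ⟨1, -t⟩ ^ 2) * (⟨t, r⟩ * ⟨t, -r⟩)
      + 2 * P.β₁ * (⟨t, r⟩ ^ 2 + ⟨t, -r⟩ ^ 2) * (⟨1, t⟩ * ⟨1, -t⟩)
      + P.γ₁ * (⟨1, t⟩ ^ 2 * ⟨t, r⟩ ^ 2 + ⟨1, -t⟩ ^ 2 * ⟨t, -r⟩ ^ 2)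
      + P.γ₂ * (⟨1, t⟩ ^ 2 * ⟨t, -r⟩ ^ 2 + ⟨1, -t⟩ ^ 2 * ⟨t, r⟩ ^ 2) := by
  apply Complex.ext <;> simp [meanReal, pow_succ] <;> ring

/-- Here `⟨1, -t⟩` and `⟨t, -r⟩` are the conjugates of `⟨1, t⟩` and `⟨t, r⟩`. The coefficients `α₁,
β₁, γᵢ` multiply sums of conjugates and feed the real part; `α₂, β₂` multiply differences and feed
the imaginary part. The same split governs `symbol₀₁_mk` and `symbol₂₁_mk`. -/
lemma symbol₁₁_mk :
    (⟨symbol₁₁Re P r t, symbol₁₁Im P r t⟩ : ℂ) =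
      ((P.α₁ - P.α₂) * ⟨t, -r⟩ ^ 2 + (P.α₁ + P.α₂) * ⟨t, r⟩ ^ 2) * (⟨1, t⟩ * ⟨1, -t⟩)
      + ((P.β₁ - P.β₂) * ⟨1, -t⟩ ^ 2 + (P.β₁ + P.β₂) * ⟨1, t⟩ ^ 2) * (⟨t, r⟩ * ⟨t, -r⟩)
      + (P.γ₁ + P.γ₂) * ((⟨1, t⟩ * ⟨1, -t⟩) * (⟨t, r⟩ * ⟨t, -r⟩)) := by
  apply Complex.ext <;> simp [symbol₁₁Re, symbol₁₁Im, pow_succ] <;> ring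

lemma symbol₀₁_mk :
    (⟨symbol₀₁Re P r t, symbol₀₁Im P r t⟩ : ℂ) =
      (P.α₁ - P.α₂) * ((⟨1, -t⟩ + ⟨1, t⟩) * ⟨t, -r⟩) + (P.α₁ + P.α₂) * ((⟨1, -t⟩ + ⟨1, t⟩) * ⟨t, r⟩)
      + (P.β₁ - P.β₂) * (⟨1, -t⟩ * (⟨t, -r⟩ + ⟨t, r⟩)) + (P.β₁ + P.β₂) * (⟨1, t⟩ * (⟨t, -r⟩ + ⟨t, r⟩))
      + P.γ₁ * (⟨1, -t⟩ * ⟨t, -r⟩ + ⟨1, t⟩ * ⟨t, r⟩)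
      + P.γ₂ * (⟨1, t⟩ * ⟨t, -r⟩ + ⟨1, -t⟩ * ⟨t, r⟩) := by
  apply Complex.ext <;> simp [symbol₀₁Re, symbol₀₁Im] <;> ring

lemma symbol₂₁_mk :
    (⟨symbol₂₁Re P r t, symbol₂₁Im P r t⟩ : ℂ) =
      ((P.α₁ - P.α₂) * ⟨t, -r⟩ + (P.α₁ + P.α₂) * ⟨t, r⟩) * (⟨1, t⟩ ^ 3 + ⟨1, -t⟩ ^ 3)
          * (⟨t, r⟩ * ⟨t, -r⟩)
      + ((P.β₁ - P.β₂) * ⟨1, -t⟩ + (P.β₁ + P.β₂) * ⟨1, t⟩) * (⟨t, r⟩ ^ 3 + ⟨t, -r⟩ ^ 3)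
          * (⟨1, t⟩ * ⟨1, -t⟩)
      + P.γ₁ * (⟨1, t⟩ ^ 3 * ⟨t, r⟩ ^ 3 + ⟨1, -t⟩ ^ 3 * ⟨t, -r⟩ ^ 3)
      + P.γ₂ * (⟨1, -t⟩ ^ 3 * ⟨t, r⟩ ^ 3 + ⟨1, t⟩ ^ 3 * ⟨t, -r⟩ ^ 3) := by
  apply Complex.ext <;> simp [symbol₂₁Re, symbol₂₁Im, pow_succ] <;> ring

variable (P) in
/-- `symbolCubic P (z / w) (Z / Y)` up to the factor `z Z / (z w Z Y)²`. -/
def symbolCubicPoly (z w Z Y : ℂ) : ℂ :=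
  (P.ξ₁ - P.ξ₃) * (z ^ 2 * w * (Z ^ 2 * Y) + w ^ 3 * (Z ^ 2 * Y) + z ^ 2 * w * Y ^ 3)
    + (P.ξ₁ + P.ξ₃) * (z ^ 3 * (Z ^ 2 * Y) + z * w ^ 2 * (Z ^ 2 * Y) + z * w ^ 2 * Y ^ 3)
    + (P.ξ₂ - P.ξ₄) * (z * w ^ 2 * Z ^ 3 + z ^ 3 * (Z * Y ^ 2) + z * w ^ 2 * (Z * Y ^ 2))
    + (P.ξ₂ + P.ξ₄) * (z ^ 2 * w * Z ^ 3 + z ^ 2 * w * (Z * Y ^ 2) + w ^ 3 * (Z * Y ^ 2))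

lemma symbolCubicPoly_im :
    (symbolCubicPoly P ⟨1, t⟩ ⟨1, -t⟩ ⟨t, r⟩ ⟨t, -r⟩).im = symbolCubicIm P r t := by
  simp [symbolCubicPoly, symbolCubicIm, pow_succ]
  ring

section Symbols

variable {z w Z Y : ℂ}

lemma symbolCubic_div (hz : z ≠ 0) (hw : w ≠ 0) (hZ : Z ≠ 0) (hY : Y ≠ 0) :
    symbolCubic P (z / w) (Z / Y) * ((z * w) * (Z * Y)) ^ 2 =
      z * Z * symbolCubicPoly P z w Z Y := by
  rw [symbolCubic, symbolCubicPoly]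
  field_simp

end Symbols

lemma normFactor_ne_zero (ht : t ≠ 0) : normFactor r t ≠ 0 := by
  unfold normFactor
  positivity

lemma linSymbol_sq_eq (ht : t ≠ 0) (h₁ : P.a₁ = l * (r + 1)) (h₂ : P.a₂ = l * (r - 1)) :
    linSymbol P ((⟨1, t⟩ / ⟨1, -t⟩ : ℂ) ^ 2) ((⟨t, r⟩ / ⟨t, -r⟩ : ℂ) ^ 2) * (normFactor r t : ℂ)
      = (⟨1, t⟩ / ⟨1, -t⟩) * (⟨t, r⟩ / ⟨t, -r⟩) * (linTwo l r t : ℂ) := by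
  have hw : (⟨1, -t⟩ : ℂ) ≠ 0 := mk_ne_zero_of_re one_ne_zero
  have hY : (⟨t, -r⟩ : ℂ) ≠ 0 := mk_ne_zero_of_re ht
  rw [linSymbol, h₁, h₂, ofReal_linTwo, ofReal_normFactor]
  field_simp
  ring

/-- If the nonlinear coefficient is real at `κ = 2 arctan t`, a polynomial in `t` vanishes. -/
lemma imaginaryPart_eq_zero (hl : l ≠ 0) (hr : r ≠ 0) (ht : t ≠ 0) (h₁ : P.a₁ = l * (r + 1))
    (h₂ : P.a₂ = l * (r - 1)) (hm : linTwo l r t ≠ 0) {K Ω : ℂ} (hK : K = ⟨1, t⟩ / ⟨1, -t⟩)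
    (hΩ : Ω = ⟨t, r⟩ / ⟨t, -r⟩) {ρ : ℝ}
    (h : cubicCoeff P K Ω / (-Complex.I * (P.a₁ * (K * Ω) + P.a₂ * Ω)) = ρ)
    (h0 : P.a₁ * (K * Ω) + P.a₂ * Ω ≠ 0) :
    4 * l * r * (linTwo l r t * symbolCubicIm P r t
        - (symbol₂₁Re P r t * symbol₁₁Im P r t + symbol₂₁Im P r t * symbol₁₁Re P r t))
      - symbol₀₁Im P r t * meanReal P r t * linTwo l r t = 0 := by
  have hz : (⟨1, t⟩ : ℂ) ≠ 0 := mk_ne_zero_of_re one_ne_zero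
  have hw : (⟨1, -t⟩ : ℂ) ≠ 0 := mk_ne_zero_of_re one_ne_zero
  have hZ : (⟨t, r⟩ : ℂ) ≠ 0 := mk_ne_zero_of_re ht
  have hY : (⟨t, -r⟩ : ℂ) ≠ 0 := mk_ne_zero_of_re ht
  have hl' : (l : ℂ) ≠ 0 := mod_cast hl
  have hr' : (r : ℂ) ≠ 0 := mod_cast hr
  have hm' : (linTwo l r t : ℂ) ≠ 0 := mod_cast hm
  have hn' : (normFactor r t : ℂ) ≠ 0 := mod_cast normFactor_ne_zero ht
  -- Up to a positive real factor, `⟨t, r⟩ / ⟨1, -t⟩` is `⟨1, t⟩ * ⟨t, r⟩`, the phase carried by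
  -- every term of `cubicCoeff`.
  have hc : -Complex.I * (P.a₁ * (K * Ω) + P.a₂ * Ω) * (⟨1, -t⟩ : ℂ) = 2 * l * ⟨t, r⟩ := by
    have hY' : P.a₁ * (⟨1, t⟩ : ℂ) + P.a₂ * ⟨1, -t⟩ = 2 * l * Complex.I * ⟨t, -r⟩ := by
      rw [h₁, h₂]
      apply Complex.ext <;> simp <;> ring
    have : -Complex.I * (P.a₁ * (K * Ω) + P.a₂ * Ω) * (⟨1, -t⟩ : ℂ)
        = -Complex.I * (P.a₁ * (⟨1, t⟩ : ℂ) + P.a₂ * ⟨1, -t⟩) * ⟨t, r⟩ / ⟨t, -r⟩ := by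
      rw [hK, hΩ]
      field_simp
    rw [this, hY', div_eq_iff hY]
    linear_combination (-2 * l * (⟨t, -r⟩ : ℂ) * ⟨t, r⟩) * Complex.I_sq
  have hc0 : -Complex.I * (P.a₁ * (K * Ω) + P.a₂ * Ω) ≠ 0 :=
    mul_ne_zero (neg_ne_zero.mpr Complex.I_ne_zero) h0
  rw [div_eq_iff hc0] at h
  have hcub : symbolCubic P K Ω * (normFactor r t : ℂ) ^ 2
      = ⟨1, t⟩ * ⟨t, r⟩ * symbolCubicPoly P ⟨1, t⟩ ⟨1, -t⟩ ⟨t, r⟩ ⟨t, -r⟩ := by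
    rw [hK, hΩ, ofReal_normFactor, symbolCubic_div hz hw hZ hY]
  have h21 : symbol₂₁ P K Ω * (normFactor r t : ℂ) ^ 2
      = ⟨1, t⟩ * ⟨t, r⟩ * ⟨symbol₂₁Re P r t, symbol₂₁Im P r t⟩ := by
    rw [hK, hΩ, ofReal_normFactor, symbol₂₁_mk, symbol₂₁]
    field_simp
    ring
  have h11 : symbol₁₁ P K Ω * (normFactor r t : ℂ)
      = K * Ω * ⟨symbol₁₁Re P r t, symbol₁₁Im P r t⟩ := by
    rw [hK, hΩ, ofReal_normFactor, symbol₁₁_mk, symbol₁₁]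
    field_simp
    ring
  have h01 : symbol₀₁ P K Ω * (normFactor r t : ℂ)
      = ⟨1, t⟩ * ⟨t, r⟩ * ⟨symbol₀₁Re P r t, symbol₀₁Im P r t⟩ := by
    rw [hK, hΩ, ofReal_normFactor, symbol₀₁_mk, symbol₀₁]
    field_simp
  have hmean : symbolMean P K Ω * (normFactor r t : ℂ) = (meanReal P r t : ℂ) := by
    rw [hK, hΩ, ofReal_normFactor, ofReal_meanReal, symbolMean]
    field_simp
  have hlin : linSymbol P (K ^ 2) (Ω ^ 2) * (normFactor r t : ℂ)
      = K * Ω * (linTwo l r t : ℂ) := by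
    rw [hK, hΩ]
    exact linSymbol_sq_eq ht h₁ h₂
  have hK0 : K ≠ 0 := hK ▸ div_ne_zero hz hw
  have hΩ0 : Ω ≠ 0 := hΩ ▸ div_ne_zero hZ hY
  have hsum : (2 : ℂ) * (P.a₁ + P.a₂) = 4 * l * r := by
    rw [h₁, h₂]
    push_cast
    ring
  rw [cubicCoeff, hsum, eq_div_of_mul_eq hn' hlin, eq_div_of_mul_eq hn' h11,
    eq_div_of_mul_eq hn' h01, eq_div_of_mul_eq hn' hmean,
    eq_div_of_mul_eq (pow_ne_zero 2 hn') hcub, eq_div_of_mul_eq (pow_ne_zero 2 hn') h21,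
    eq_div_of_mul_eq hw hc] at h
  -- Denominators cleared and the common phase cancelled: the right-hand side is real because `ρ`
  -- is.
  have key : 4 * l * r * ((linTwo l r t : ℂ) * symbolCubicPoly P ⟨1, t⟩ ⟨1, -t⟩ ⟨t, r⟩ ⟨t, -r⟩
        - ⟨symbol₂₁Re P r t, symbol₂₁Im P r t⟩ * ⟨symbol₁₁Re P r t, symbol₁₁Im P r t⟩)
      - ⟨symbol₀₁Re P r t, symbol₀₁Im P r t⟩ * (meanReal P r t : ℂ) * (linTwo l r t : ℂ)
      = ((ρ * (8 * l ^ 2 * r * linTwo l r t * normFactor r t * (t ^ 2 + r ^ 2)) : ℝ) : ℂ) := by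
    have hn2 : ((t ^ 2 + r ^ 2 : ℝ) : ℂ) = normFactor r t / (⟨1, t⟩ * ⟨1, -t⟩) := by
      rw [ofReal_normFactor, mul_conj_mk t r]
      field_simp
    rw [Complex.ofReal_mul, Complex.ofReal_mul, hn2]
    clear hcub h21 h11 h01 hmean hlin hc hc0 h0
    generalize symbolCubicPoly P ⟨1, t⟩ ⟨1, -t⟩ ⟨t, r⟩ ⟨t, -r⟩ = X at *
    field_simp at h
    push_cast
    field_simp
    linear_combination h
  have him := congrArg Complex.im key
  rw [Complex.ofReal_im] at him
  rw [← him, ← symbolCubicPoly_im]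
  simp

lemma imaginaryPart_eq_sum_imCoeff :
    4 * l * r * (linTwo l r t * symbolCubicIm P r t
        - (symbol₂₁Re P r t * symbol₁₁Im P r t + symbol₂₁Im P r t * symbol₁₁Re P r t))
      - symbol₀₁Im P r t * meanReal P r t * linTwo l r t
      = -16 * l * r * ∑ i ∈ Finset.range 6, imCoeff P l r i * (t ^ 2) ^ i := by
  simp only [Finset.sum_range_succ, Finset.sum_range_zero, imCoeff, linTwo, symbolCubicIm,
    symbol₂₁Re, symbol₂₁Im, symbol₁₁Re, symbol₁₁Im, symbol₀₁Im, meanReal]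
  ring

end ImaginaryPart

end RealityCondition

/-! ### From reality at all nonresonant wave numbers to the six families -/

section Conclusion

/-- The factor `m` absorbs the excluded points: the product with `m` vanishes on all of `(0, ∞)`,
hence identically. -/
lemma coeff_eq_zero_of_eval_eq_zero {N : ℕ} {c : ℕ → ℝ} {m : Polynomial ℝ} (hm : m ≠ 0)
    (h : ∀ x : ℝ, 0 < x → m.eval x ≠ 0 → ∑ i ∈ Finset.range N, c i * x ^ i = 0) :
    ∀ i < N, c i = 0 := by
  set p : Polynomial ℝ := ∑ i ∈ Finset.range N, Polynomial.C (c i) * Polynomial.X ^ i with hp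
  have hz : p * m = 0 := by
    refine Polynomial.eq_zero_of_infinite_isRoot _ ((Set.Ioi_infinite (0 : ℝ)).mono fun x hx => ?_)
    rw [Set.mem_ofPred_eq, Polynomial.IsRoot, Polynomial.eval_mul]
    by_cases hx' : m.eval x = 0
    · rw [hx', mul_zero]
    · rw [hp, Polynomial.eval_finsetSum]
      simp only [Polynomial.eval_mul, Polynomial.eval_C, Polynomial.eval_pow, Polynomial.eval_X]
      rw [h x hx hx', zero_mul]
  intro i hi
  have : p.coeff i = c i := by
    simp [hp, Polynomial.finsetSum_coeff, Polynomial.coeff_X_pow, hi]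
  rw [← this, (mul_eq_zero.mp hz).resolve_right hm, Polynomial.coeff_zero]

theorem mem_families_of_isA₁Integrable {P : Coeffs} (ha₁ : P.a₁ ≠ 0) (ha₂ : P.a₂ ≠ 0)
    (ha : |P.a₁| ≠ |P.a₂|) (h : IsA₁Integrable P) :
    S1 P ∨ S2 P ∨ S3 P ∨ S4 P ∨ S5 P ∨ S6 P := by
  have hsub : P.a₁ - P.a₂ ≠ 0 := fun e => ha (by rw [sub_eq_zero.mp e])
  have hadd := add_ne_zero_of_abs_ne ha
  obtain ⟨l, hl_def⟩ : ∃ l, l = (P.a₁ - P.a₂) / 2 := ⟨_, rfl⟩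
  obtain ⟨r, hr_def⟩ : ∃ r, r = (P.a₁ + P.a₂) / (P.a₁ - P.a₂) := ⟨_, rfl⟩
  have hl : l ≠ 0 := hl_def ▸ div_ne_zero hsub two_ne_zero
  have hr : r ≠ 0 := hr_def ▸ div_ne_zero hadd hsub
  have h₁ : P.a₁ = l * (r + 1) := by rw [hl_def, hr_def]; field_simp; ring
  have h₂ : P.a₂ = l * (r - 1) := by rw [hl_def, hr_def]; field_simp; ring
  have hr₁ : r ^ 2 ≠ 1 := by
    intro e
    have : P.a₁ * P.a₂ = 0 := by rw [h₁, h₂]; linear_combination l ^ 2 * e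
    exact (mul_ne_zero ha₁ ha₂) this
  obtain ⟨ω, hω⟩ := exists_isDispersionRelation ha
  refine mem_families_of_imCoeff_eq_zero hl hr hr₁ h₁ h₂ ?_
  -- The resonance polynomial `linTwo / (4 l r)` in `x = t²`; it is nonzero because its value at `0`
  -- is `-r²`.
  refine coeff_eq_zero_of_eval_eq_zero (m := (1 - Polynomial.X) * (Polynomial.X
    - Polynomial.C (r ^ 2)) - 4 * Polynomial.X) ?_ ?_
  · intro e
    have := congrArg (Polynomial.eval 0) e
    simp [hr] at this
  intro x hx hx'
  obtain ⟨t, ht, rfl⟩ : ∃ t : ℝ, 0 < t ∧ t ^ 2 = x :=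
    ⟨Real.sqrt x, Real.sqrt_pos.mpr hx, Real.sq_sqrt hx.le⟩
  have hm : linTwo l r t ≠ 0 := by
    refine mul_ne_zero (mul_ne_zero (mul_ne_zero four_ne_zero hl) hr) ?_
    simpa using hx'
  have hK := waveK_two_arctan t
  have hΩ := waveΩ_two_arctan hl ht.ne' h₁ h₂ hω
  have hκ : IsNonresonant P ω (2 * Real.arctan t) := by
    constructor
    · refine (Real.sin_pos_of_pos_of_lt_pi ?_ ?_).ne'
      · have := Real.arctan_pos.mpr ht
        linarith
      · have := Real.arctan_lt_pi_div_two t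
        linarith
    · intro e
      have hz : (⟨1, t⟩ : ℂ) ≠ 0 := mk_ne_zero_of_re one_ne_zero
      have hw : (⟨1, -t⟩ : ℂ) ≠ 0 := mk_ne_zero_of_re one_ne_zero
      have hZ : (⟨t, r⟩ : ℂ) ≠ 0 := mk_ne_zero_of_re ht.ne'
      have hY : (⟨t, -r⟩ : ℂ) ≠ 0 := mk_ne_zero_of_re ht.ne'
      have hs := linSymbol_sq_eq ht.ne' h₁ h₂
      rw [← hK, ← hΩ, e, zero_mul, hK, hΩ] at hs
      exact mul_ne_zero (mul_ne_zero (div_ne_zero hz hw) (div_ne_zero hZ hY))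
        (Complex.ofReal_ne_zero.mpr hm) hs.symm
  obtain ⟨ρ₁, ρ₂, hρ⟩ := h ω hω _ hκ
  obtain ⟨σ, hσ⟩ := reducesToNLS ha hω hκ
  have him := imaginaryPart_eq_zero hl hr ht.ne' h₁ h₂ hm hK hΩ
    (hσ.unique ha hω hκ hρ).2 (symbolTime_ne_zero ha ω _)
  rw [imaginaryPart_eq_sum_imCoeff] at him
  exact (mul_eq_zero.mp him).resolve_left
    (mul_ne_zero (mul_ne_zero (by norm_num) hl) hr)

end Conclusion

end QPlus

end

theorem mainTheorem2 (P : QPlus.Coeffs)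
    (ha₁ : P.a₁ ≠ 0) (ha₂ : P.a₂ ≠ 0) (ha : |P.a₁| ≠ |P.a₂|)
    (h : ¬ (QPlus.S1 P ∨ QPlus.S2 P ∨ QPlus.S3 P ∨ QPlus.S4 P ∨ QPlus.S5 P ∨ QPlus.S6 P)) :
    (∀ ω : ℝ → ℝ, QPlus.IsDispersionRelation P ω → ∀ κ : ℝ, QPlus.IsNonresonant P ω κ →
      ∃! ρ : ℂ × ℂ, QPlus.ReducesToNLS P ω κ ρ.1 ρ.2) ∧
    ¬ QPlus.IsA₁Integrable P := by
  refine ⟨fun ω hω κ hκ => ?_, fun hI => h (QPlus.mem_families_of_isA₁Integrable ha₁ ha₂ ha hI)⟩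
  obtain ⟨ρ₁, hρ⟩ := QPlus.reducesToNLS ha hω hκ
  refine ⟨(ρ₁, _), hρ, fun σ hσ => ?_⟩
  have := hσ.unique ha hω hκ hρ
  exact Prod.ext this.1 this.2
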